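/- Let $p$ be a prime number. Let $\mathbb A_{\mathbb Q,p}=\{a\in\mathbb A_{\mathbb Q} : a_p=0\}$ be the space of adeles of $\mathbb Q$ with vanishing component at $p$, let $$\mathbb A^{(1)}_{\mathbb Q,p}=\{a\in\mathbb A_{\mathbb Q,p} : |a_w|\le 1 \text{ for all finite places } w,\ |a_\infty|<1\},$$ $$\mathbb A^{*}_{\mathbb Q,p}=\{a\in\mathbb A_{\mathbb Q,p} : |a_w|=1 \text{ for all finite places } w\ne p,\ p^{-1}\le |a_\infty|<1\},$$ and let $\mathcal G(p)=\{(k,x) : k\in\mathbb Q^*,\ x\in\mathbb A^{(1)}_{\mathbb Q,p},\ kx\in\mathbb A^{(1)}_{\mathbb Q,p}\}$ be the étale groupoid with source $x$, range $kx$ and product $(k,k'x)(k',x)=(kk',x)$ ($\mathbb Q^*$ being discrete). Let $C^*(\mathcal G(p))$ be its $C^*$-algebra, the completion of the convolution algebra $C_c(\mathcal G(p))$ in the full $C^*$-norm, with the time evolution given by $\sigma^p_t(f)(k,x)=|k|_p^{it}f(k,x)$ on $C_c(\mathcal G(p))$. For $y\in\mathbb A^{*}_{\mathbb Q,p}$ let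 $\mathcal G(p)_y=\{k\in\mathbb Q^* : ky\in\mathbb A^{(1)}_{\mathbb Q,p}\}$, let $\pi_y$ be the representation of $C^*(\mathcal G(p))$ on $\ell^2(\mathcal G(p)_y)$ by left convolution, $(\pi_y(f)\xi)(k)=\sum_{s} f(ks^{-1},sy)\,\xi(s)$, and let $H_y$ be the operator of multiplication by $\log|k|_p$ on $\ell^2(\mathcal G(p)_y)$ with its maximal domain. Then: 1. For every $y\in\mathbb A^{*}_{\mathbb Q,p}$ the representation $\pi_y$ has positive energy: the operator $H_y$ is self-adjoint and nonnegative, and it implements the time evolution, $\pi_y(\sigma^p_t(a))=e^{itH_y}\pi_y(a)e^{-itH_y}$ for all $a\in C^*(\mathcal G(p))$ and $t\in\mathbb R$. The spectrum of $H_y$ is $\{k\log p : k\in\mathbb N\cup\{0\}\}$. 2. Let $\beta>1$, let $y\in\mathbb A^{*}_{\mathbb Q,p}$, and let $\lambda\in(1,p]$ be given by $|y_\infty|=\lambda^{-1}$. Then $e^{-\beta H_y}$ is of trace class and $$Z_p(\lambda,\beta)=\operatorname{Tr}(e^{-\beta H_y})=2\,\frac{1-p^{-\beta}}{1-p^{1-\beta}}\,f_p(\lambda,\beta),\qquad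 f_p(\lambda,\beta)=\sum_{k\ge 0}c_k\,p^{-k\beta},$$ where $c_k=\lceil\lambda p^k-1\rceil-p\,\lceil\lambda p^{k-1}-1\rceil\in\{0,\dots,p-1\}$ are the digits of the expansion $\lambda=\sum_{k\ge0}c_kp^{-k}$ in base $p$ (the non-terminating one if there are two). 3. Let $\beta>1$. For every $y\in\mathbb A^{*}_{\mathbb Q,p}$ and $a\in C^*(\mathcal G(p))$ the operator $e^{-\beta H_y}\pi_y(a)$ is of trace class, and $$\psi_{\beta,y}(a)=\operatorname{Tr}(e^{-\beta H_y}\pi_y(a))$$ is a positive bounded linear functional of norm $Z_p(\lambda,\beta)$ on $C^*(\mathcal G(p))$ (so that $Z_p(\lambda,\beta)^{-1}\psi_{\beta,y}$ is a state) which satisfies the KMS$_\beta$ condition for $\sigma^p_t$. These functionals depend weakly continuously on $y$: for every $a\in C^*(\mathcal G(p))$ the function $y\mapsto\psi_{\beta,y}(a)$ is continuous on $\mathbb A^{*}_{\mathbb Q,p}$. -/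

import Mathlib

set_option linter.unusedSectionVars false

noncomputable section

open scoped ComplexConjugate

namespace ValuationSystem

section Groupoid

variable (Γ X : Type) [Group Γ] [TopologicalSpace X] [MulAction Γ X] (U : Set X)

/-- The slice over `k` of the reduction to `U ⊆ X` of the transformation groupoid `Γ ⋉ X`: the
points `x` for which `(k, x)` is an arrow, that is, source `x` and range `k • x` are in `U`. -/
def arrows {Γ X : Type} [Group Γ] [MulAction Γ X] (U : Set X) (k : Γ) : Set X :=
  {x | x ∈ U ∧ k • x ∈ U}

/-- For a discrete group `Γ`, a Hausdorff space `X` and an open `U`: the space `C_c(G)` of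
continuous compactly supported functions on the reduced groupoid
`G = {(k, x) | x ∈ U, k • x ∈ U}`, a function being extended by zero to `Γ × X`. -/
def ccSubmodule : Submodule ℂ (Γ → X → ℂ) where
  carrier := {f | {k | f k ≠ 0}.Finite ∧ ∀ k, Continuous (f k) ∧ HasCompactSupport (f k) ∧
    tsupport (f k) ⊆ arrows U k}
  zero_mem' := by
    refine ⟨by simp, fun k => ⟨continuous_const, HasCompactSupport.zero, ?_⟩⟩
    simp [tsupport]
  add_mem' := by
    rintro f g ⟨hf, hf'⟩ ⟨hg, hg'⟩
    refine ⟨(hf.union hg).subset ?_, fun k => ⟨(hf' k).1.add (hg' k).1,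
      (hf' k).2.1.add (hg' k).2.1, ?_⟩⟩
    · intro k hk
      by_contra h
      simp only [Set.mem_union, Set.mem_ofPred_eq, not_or, not_not] at h
      exact hk (by simp [h.1, h.2])
    · exact (tsupport_add (f k) (g k)).trans (Set.union_subset (hf' k).2.2 (hg' k).2.2)
  smul_mem' := by
    rintro c f ⟨hf, hf'⟩
    refine ⟨hf.subset ?_, fun k => ⟨(hf' k).1.const_smul c, ?_, ?_⟩⟩
    · intro k hk h
      exact hk (by simp [h])
    · exact (hf' k).2.1.comp_left (g := fun z => c • z) (smul_zero c)
    · exact (tsupport_smul_subset_right (fun _ => c) (f k)).trans (hf' k).2.2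

/-- The convolution algebra `C_c(G)` of the reduced groupoid. -/
def Cc : Type := ccSubmodule Γ X U

instance : AddCommGroup (Cc Γ X U) := inferInstanceAs (AddCommGroup (ccSubmodule Γ X U))
instance : Module ℂ (Cc Γ X U) := inferInstanceAs (Module ℂ (ccSubmodule Γ X U))
instance : CoeFun (Cc Γ X U) (fun _ => Γ → X → ℂ) := ⟨fun f => f.1⟩

variable {Γ X U}

namespace Cc

@[ext] theorem ext {f g : Cc Γ X U} (h : ∀ k x, f k x = g k x) : f = g :=
  Subtype.ext (funext fun k => funext fun x => h k x)

@[simp] theorem add_apply (f g : Cc Γ X U) (k : Γ) (x : X) : (f + g) k x = f k x + g k x := rfl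
@[simp] theorem zero_apply (k : Γ) (x : X) : (0 : Cc Γ X U) k x = 0 := rfl
@[simp] theorem neg_apply (f : Cc Γ X U) (k : Γ) (x : X) : (-f) k x = -f k x := rfl
@[simp] theorem smul_apply (c : ℂ) (f : Cc Γ X U) (k : Γ) (x : X) :
    (c • f) k x = c * f k x := rfl

/-- The finite set of group elements over which `f` does not vanish identically. -/
def supp (f : Cc Γ X U) : Finset Γ := f.2.1.toFinset

theorem eq_zero_of_notMem (f : Cc Γ X U) {k : Γ} (hk : k ∉ f.supp) : f k = 0 := by
  simpa [supp] using hk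

theorem mem_arrows (f : Cc Γ X U) {k : Γ} {x : X} (h : f k x ≠ 0) : x ∈ arrows U k :=
  (f.2.2 k).2.2 (subset_tsupport _ h)

end Cc

/-- Left convolution by `f` along the orbit of `x`:
`(k, x) ↦ ∑ f(γ₁) u(γ₂)` over the factorisations `(k, x) = γ₁ γ₂ = (k s⁻¹, s x) (s, x)`. -/
def act (f : Γ → X → ℂ) (x : X) (u : Γ → ℂ) (k : Γ) : ℂ :=
  ∑ᶠ s : Γ, f (k * s⁻¹) (s • x) * u s

namespace Cc

theorem act_eq_sum (f : Cc Γ X U) {S : Finset Γ} (hS : f.supp ⊆ S) (x : X) (u : Γ → ℂ) (k : Γ) :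
    act f x u k = ∑ g ∈ S, f g ((g⁻¹ * k) • x) * u (g⁻¹ * k) := by
  unfold act
  let e : Γ ≃ Γ := (Equiv.inv Γ).trans (Equiv.mulRight k)
  rw [← finsum_comp_equiv e]
  have he : ∀ g, e g = g⁻¹ * k := fun g => rfl
  simp only [he, mul_inv_rev, inv_inv, mul_inv_cancel_left]
  refine finsum_eq_sum_of_support_subset _ fun g hg => ?_
  by_contra h
  exact hg (by simp [f.eq_zero_of_notMem (fun h' => h (hS h'))])

theorem act_add_right (f : Cc Γ X U) (x : X) (u v : Γ → ℂ) (k : Γ) :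
    act f x (u + v) k = act f x u k + act f x v k := by
  simp only [f.act_eq_sum (le_refl _), ← Finset.sum_add_distrib, Pi.add_apply, mul_add]

theorem act_smul_right (f : Cc Γ X U) (c : ℂ) (x : X) (u : Γ → ℂ) (k : Γ) :
    act f x (c • u) k = c * act f x u k := by
  simp only [f.act_eq_sum (le_refl _), Finset.mul_sum, Pi.smul_apply, smul_eq_mul]
  exact Finset.sum_congr rfl fun _ _ => by ring

theorem act_add_left (f g : Cc Γ X U) (x : X) (u : Γ → ℂ) (k : Γ) :
    act (f + g : Cc Γ X U) x u k = act f x u k + act g x u k := by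
  classical
  rw [(f + g).act_eq_sum (S := f.supp ∪ g.supp ∪ (f + g).supp) (by intro; simp_all),
    f.act_eq_sum (S := f.supp ∪ g.supp ∪ (f + g).supp) (by intro; simp_all),
    g.act_eq_sum (S := f.supp ∪ g.supp ∪ (f + g).supp) (by intro; simp_all),
    ← Finset.sum_add_distrib]
  exact Finset.sum_congr rfl fun _ _ => by rw [add_apply]; ring

theorem act_smul_left (c : ℂ) (f : Cc Γ X U) (x : X) (u : Γ → ℂ) (k : Γ) :
    act (c • f : Cc Γ X U) x u k = c * act f x u k := by
  classical
  rw [(c • f).act_eq_sum (S := f.supp ∪ (c • f).supp) (by intro; simp_all),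
    f.act_eq_sum (S := f.supp ∪ (c • f).supp) (by intro; simp_all), Finset.mul_sum]
  exact Finset.sum_congr rfl fun _ _ => by rw [smul_apply]; ring

theorem act_eq_zero (f : Cc Γ X U) (x : X) (u : Γ → ℂ) {k : Γ} (hk : k • x ∉ U) :
    act f x u k = 0 := by
  rw [f.act_eq_sum (le_refl _)]
  refine Finset.sum_eq_zero fun g _ => ?_
  by_cases h : f g ((g⁻¹ * k) • x) = 0
  · simp [h]
  · exact absurd (f.mem_arrows h).2 (by simpa [smul_smul] using hk)

variable [ContinuousConstSMul Γ X]

theorem conv_mem (f g : Cc Γ X U) :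
    (fun k x => act f x (fun s => g s x) k) ∈ ccSubmodule Γ X U := by
  classical
  have key : ∀ k, (fun x => act f x (fun s => g s x) k) =
      ∑ a ∈ f.supp, fun x => f a ((a⁻¹ * k) • x) * g (a⁻¹ * k) x := by
    intro k
    funext x
    rw [f.act_eq_sum (le_refl _), Finset.sum_apply]
  have hterm : ∀ k a, Continuous (fun x => f a ((a⁻¹ * k) • x) * g (a⁻¹ * k) x) ∧
      HasCompactSupport (fun x => f a ((a⁻¹ * k) • x) * g (a⁻¹ * k) x) ∧
      tsupport (fun x => f a ((a⁻¹ * k) • x) * g (a⁻¹ * k) x) ⊆ arrows U k := by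
    intro k a
    refine ⟨((f.2.2 a).1.comp (continuous_const_smul _)).mul (g.2.2 _).1,
      (g.2.2 _).2.1.mul_left, fun x hx => ?_⟩
    have h1 : x ∈ tsupport (g (a⁻¹ * k)) := tsupport_mul_subset_right hx
    have h2 : x ∈ tsupport (fun x => f a ((a⁻¹ * k) • x)) := tsupport_mul_subset_left hx
    have h3 : (a⁻¹ * k) • x ∈ tsupport (f a) := by
      have := tsupport_comp_subset_preimage (f a) (continuous_const_smul (T := X) (a⁻¹ * k)) h2
      exact this
    refine ⟨((g.2.2 _).2.2 h1).1, ?_⟩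
    have := ((f.2.2 a).2.2 h3).2
    simpa [smul_smul] using this
  refine ⟨(Finset.finite_toSet (Finset.image₂ (· * ·) f.supp g.supp)).subset ?_, fun k => ?_⟩
  · intro k hk
    by_contra h
    apply hk
    simp only [key]
    refine Finset.sum_eq_zero fun a ha => ?_
    have : a⁻¹ * k ∉ g.supp := fun hg => h (by
      simp only [Finset.coe_image₂, Set.mem_image2, Finset.mem_coe]
      exact ⟨a, ha, a⁻¹ * k, hg, by simp⟩)
    funext x
    simp [g.eq_zero_of_notMem this]
  · have h : (fun x => act f x (fun s => g s x) k) ∈ {φ : X → ℂ | Continuous φ ∧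
        HasCompactSupport φ ∧ tsupport φ ⊆ arrows U k} := by
      rw [key]
      refine Finset.sum_induction _ (· ∈ {φ : X → ℂ | Continuous φ ∧
        HasCompactSupport φ ∧ tsupport φ ⊆ arrows U k}) ?_ ?_ (fun a _ => hterm k a)
      · rintro φ ψ ⟨h1, h2, h3⟩ ⟨h1', h2', h3'⟩
        exact ⟨h1.add h1', h2.add h2', (tsupport_add φ ψ).trans (Set.union_subset h3 h3')⟩
      · exact ⟨continuous_const, HasCompactSupport.zero, by simp [tsupport]⟩
    exact h

/-- The convolution product `(f * g)(k, x) = ∑ₛ f(k s⁻¹, s x) g(s, x)`. -/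
instance : Mul (Cc Γ X U) := ⟨fun f g => ⟨fun k x => act f x (fun s => g s x) k, conv_mem f g⟩⟩

theorem mul_apply (f g : Cc Γ X U) (k : Γ) (x : X) :
    (f * g) k x = act f x (fun s => g s x) k := rfl

theorem act_mul (f g : Cc Γ X U) (x : X) (u : Γ → ℂ) (k : Γ) :
    act (f * g : Cc Γ X U) x u k = act f x (act g x u) k := by
  rw [f.act_eq_sum (le_refl _)]
  have h1 : ∀ s, (f * g) (k * s⁻¹) (s • x) * u s =
      ∑ a ∈ f.supp, f a ((a⁻¹ * k) • x) * (g (a⁻¹ * k * s⁻¹) (s • x) * u s) := by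
    intro s
    rw [mul_apply, f.act_eq_sum (le_refl _), Finset.sum_mul]
    refine Finset.sum_congr rfl fun a _ => ?_
    rw [smul_smul]
    simp only [mul_assoc, inv_mul_cancel, mul_one]
  unfold act
  simp only [h1]
  rw [finsum_sum_comm]
  · refine Finset.sum_congr rfl fun a _ => ?_
    rw [← mul_finsum]
  · intro a _
    have hfin := (g.supp.finite_toSet).preimage
      (f := fun s : Γ => a⁻¹ * k * s⁻¹) (by intro s _ t _ h; simpa using h)
    refine hfin.subset fun s hs => ?_
    by_contra h
    exact hs (by simp [g.eq_zero_of_notMem h])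

theorem star_mem (f : Cc Γ X U) :
    (fun k x => conj (f k⁻¹ (k • x))) ∈ ccSubmodule Γ X U := by
  refine ⟨?_, fun k => ⟨?_, ?_, ?_⟩⟩
  · refine ((f.supp.finite_toSet).preimage (f := fun k : Γ => k⁻¹) inv_injective.injOn).subset
      fun k hk => ?_
    by_contra h
    exact hk (by funext x; simp [f.eq_zero_of_notMem h])
  · exact Complex.continuous_conj.comp ((f.2.2 k⁻¹).1.comp (continuous_const_smul k))
  · exact ((f.2.2 k⁻¹).2.1.comp_homeomorph (Homeomorph.smul k)).comp_left (map_zero _)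
  · intro x hx
    have h1 : x ∈ tsupport (fun x => f k⁻¹ (k • x)) :=
      tsupport_comp_subset (map_zero (starRingEnd ℂ)) (fun x => f k⁻¹ (k • x)) hx
    have h2 := tsupport_comp_subset_preimage (f k⁻¹) (continuous_const_smul (T := X) k) h1
    have h3 := (f.2.2 k⁻¹).2.2 h2
    exact ⟨by simpa using h3.2, h3.1⟩

/-- The involution `f*(k, x) = conj f(k⁻¹, k x)`. -/
instance : Star (Cc Γ X U) := ⟨fun f => ⟨fun k x => conj (f k⁻¹ (k • x)), star_mem f⟩⟩

theorem star_apply (f : Cc Γ X U) (k : Γ) (x : X) : (star f) k x = conj (f k⁻¹ (k • x)) := rfl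

instance : NonUnitalRing (Cc Γ X U) where
  left_distrib f g h := by ext k x; exact f.act_add_right x _ _ k
  right_distrib f g h := by ext k x; exact f.act_add_left g x _ k
  zero_mul f := by
    ext k x
    have := act_smul_left 0 (0 : Cc Γ X U) x (fun s => f s x) k
    rw [zero_smul, zero_mul] at this
    exact this
  mul_zero f := by
    ext k x
    have := f.act_smul_right 0 x 0 k
    rw [zero_smul, zero_mul] at this
    exact this
  mul_assoc f g h := by ext k x; exact act_mul f g x _ k

instance : IsScalarTower ℂ (Cc Γ X U) (Cc Γ X U) :=
  ⟨fun c f g => by ext k x; exact act_smul_left c f x _ k⟩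

instance : SMulCommClass ℂ (Cc Γ X U) (Cc Γ X U) :=
  ⟨fun c f g => by ext k x; exact (f.act_smul_right c x _ k).symm⟩

instance : StarRing (Cc Γ X U) where
  star_involutive f := by ext k x; simp [star_apply, smul_smul]
  star_add f g := by ext k x; simp [star_apply]
  star_mul f g := by
    ext k x
    rw [star_apply, mul_apply, mul_apply]
    unfold act
    rw [← finsum_comp_equiv (Equiv.mulRight k⁻¹)]
    have hfin : (fun s => f (k⁻¹ * (s * k⁻¹)⁻¹) ((s * k⁻¹) • k • x) *
        g (s * k⁻¹) (k • x)).support.Finite := by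
      refine ((g.supp.finite_toSet).preimage (f := fun s : Γ => s * k⁻¹)
        (mul_left_injective _).injOn).subset fun s hs => ?_
      by_contra h
      exact hs (by simp [g.eq_zero_of_notMem h])
    have := AddMonoidHom.map_finsum (starRingEnd ℂ : ℂ →+* ℂ).toAddMonoidHom hfin
    refine this.trans (finsum_congr fun s => ?_)
    simp [star_apply, smul_smul, mul_comm]

instance : StarModule ℂ (Cc Γ X U) := ⟨fun c f => by ext k x; simp [star_apply]⟩

/-- The norm of `ℓ¹(Γ, C₀(X))`: `∑ₖ supₓ |f(k, x)|`. -/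
def ellOne (f : Cc Γ X U) : ℝ := ∑ k ∈ f.supp, ⨆ x, ‖f k x‖

theorem bddAbove_norm (f : Cc Γ X U) (k : Γ) : BddAbove (Set.range fun x => ‖f k x‖) := by
  obtain ⟨C, hC⟩ := (f.2.2 k).2.1.exists_bound_of_continuous (f.2.2 k).1
  exact ⟨C, by rintro _ ⟨x, rfl⟩; exact hC x⟩

theorem norm_le_iSup (f : Cc Γ X U) (k : Γ) (x : X) : ‖f k x‖ ≤ ⨆ x, ‖f k x‖ :=
  le_ciSup (f.bddAbove_norm k) x

theorem iSup_nonneg (f : Cc Γ X U) (k : Γ) : 0 ≤ ⨆ x, ‖f k x‖ :=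
  Real.iSup_nonneg fun _ => norm_nonneg _

theorem ellOne_nonneg (f : Cc Γ X U) : 0 ≤ f.ellOne :=
  Finset.sum_nonneg fun k _ => f.iSup_nonneg k

/-- The C⋆-seminorms on the involutive algebra `C_c(G)`. The bound by the `ℓ¹`-norm is the usual
boundedness requirement on the representations of `C_c(G)` that define the full C⋆-norm (for the
groupoids considered here every C⋆-seminorm on `C_c(G)` satisfies it). -/
structure IsCStarSeminorm (q : Seminorm ℂ (Cc Γ X U)) : Prop where
  mul_le : ∀ f g, q (f * g) ≤ q f * q g
  star_mul_self : ∀ f, q (star f * f) = q f ^ 2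
  le_ellOne : ∀ f, q f ≤ f.ellOne

theorem isCStarSeminorm_zero : IsCStarSeminorm (0 : Seminorm ℂ (Cc Γ X U)) :=
  ⟨fun _ _ => by simp, fun _ => by simp, fun f => f.ellOne_nonneg⟩

instance : Nonempty {q : Seminorm ℂ (Cc Γ X U) // IsCStarSeminorm q} :=
  ⟨⟨0, isCStarSeminorm_zero⟩⟩

/-- The full C⋆-norm on `C_c(G)`: the largest C⋆-seminorm. -/
def fullNorm (f : Cc Γ X U) : ℝ := ⨆ q : {q : Seminorm ℂ (Cc Γ X U) // IsCStarSeminorm q}, q.1 f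

theorem bddAbove_fullNorm (f : Cc Γ X U) :
    BddAbove (Set.range fun q : {q : Seminorm ℂ (Cc Γ X U) // IsCStarSeminorm q} => q.1 f) :=
  ⟨f.ellOne, by rintro _ ⟨q, rfl⟩; exact q.2.le_ellOne f⟩

theorem le_fullNorm {q : Seminorm ℂ (Cc Γ X U)} (hq : IsCStarSeminorm q) (f : Cc Γ X U) :
    q f ≤ f.fullNorm :=
  le_ciSup f.bddAbove_fullNorm ⟨q, hq⟩

theorem fullNorm_le {f : Cc Γ X U} {C : ℝ}
    (h : ∀ q : Seminorm ℂ (Cc Γ X U), IsCStarSeminorm q → q f ≤ C) : f.fullNorm ≤ C :=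
  ciSup_le fun q => h q.1 q.2

theorem fullNorm_nonneg (f : Cc Γ X U) : 0 ≤ f.fullNorm :=
  (apply_nonneg _ f).trans (le_fullNorm isCStarSeminorm_zero f)

theorem fullNorm_le_ellOne (f : Cc Γ X U) : f.fullNorm ≤ f.ellOne :=
  fullNorm_le fun _ hq => hq.le_ellOne f

theorem IsCStarSeminorm.star_le {q : Seminorm ℂ (Cc Γ X U)} (hq : IsCStarSeminorm q)
    (f : Cc Γ X U) : q (star f) ≤ q f := by
  have h1 := hq.star_mul_self (star f)
  have h2 := hq.mul_le (star (star f)) (star f)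
  rw [h1, star_star, pow_two] at h2
  rcases (apply_nonneg q (star f)).eq_or_lt with h | h
  · rw [← h]; exact apply_nonneg q f
  · exact le_of_mul_le_mul_right h2 h

theorem fullNorm_mul_le (f g : Cc Γ X U) : (f * g).fullNorm ≤ f.fullNorm * g.fullNorm :=
  fullNorm_le fun _ hq => (hq.mul_le f g).trans
    (mul_le_mul (le_fullNorm hq f) (le_fullNorm hq g) (apply_nonneg _ _) f.fullNorm_nonneg)

theorem fullNorm_star_le (f : Cc Γ X U) : (star f).fullNorm ≤ f.fullNorm :=
  fullNorm_le fun _ hq => (hq.star_le f).trans (le_fullNorm hq f)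

theorem fullNorm_star (f : Cc Γ X U) : (star f).fullNorm = f.fullNorm :=
  le_antisymm f.fullNorm_star_le (by simpa using (star f).fullNorm_star_le)

theorem sq_fullNorm_le (f : Cc Γ X U) : f.fullNorm * f.fullNorm ≤ (star f * f).fullNorm := by
  rw [← pow_two]
  refine (Real.le_sqrt f.fullNorm_nonneg (star f * f).fullNorm_nonneg).mp
    (fullNorm_le fun q hq => Real.le_sqrt_of_sq_le ?_)
  rw [← hq.star_mul_self]
  exact le_fullNorm hq _

/-- The full C⋆-norm as a seminorm. -/
def fullSeminorm : Seminorm ℂ (Cc Γ X U) :=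
  Seminorm.ofSMulLE fullNorm
    (le_antisymm (fullNorm_le fun q _ => by simp) (fullNorm_nonneg 0))
    (fun f g => fullNorm_le fun q hq => (map_add_le_add q f g).trans
      (add_le_add (le_fullNorm hq f) (le_fullNorm hq g)))
    (fun c f => fullNorm_le fun q hq => by
      rw [map_smul_eq_mul]
      exact mul_le_mul_of_nonneg_left (le_fullNorm hq f) (norm_nonneg c))

instance : SeminormedAddCommGroup (Cc Γ X U) :=
  (fullSeminorm (Γ := Γ) (X := X) (U := U)).toAddGroupSeminorm.toSeminormedAddCommGroup

theorem norm_def (f : Cc Γ X U) : ‖f‖ = f.fullNorm := rfl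

instance : NormedSpace ℂ (Cc Γ X U) where
  norm_smul_le c f := (map_smul_eq_mul (fullSeminorm (Γ := Γ) (X := X) (U := U)) c f).le

instance : NonUnitalSeminormedRing (Cc Γ X U) where
  __ := (inferInstance : SeminormedAddCommGroup (Cc Γ X U))
  __ := (inferInstance : NonUnitalRing (Cc Γ X U))
  norm_mul_le f g := fullNorm_mul_le f g

instance : NormedStarGroup (Cc Γ X U) := ⟨fun f => f.fullNorm_star_le⟩

end Cc

variable (Γ X U)
variable [ContinuousConstSMul Γ X]

/-- The (full) C⋆-algebra `C⋆(G)` of the reduced groupoid. -/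
def CStar : Type := UniformSpace.Completion (Cc Γ X U)

namespace CStar

open UniformSpace

instance : NormedAddCommGroup (CStar Γ X U) :=
  inferInstanceAs (NormedAddCommGroup (Completion (Cc Γ X U)))
instance : NormedSpace ℂ (CStar Γ X U) :=
  inferInstanceAs (NormedSpace ℂ (Completion (Cc Γ X U)))
instance : CompleteSpace (CStar Γ X U) :=
  inferInstanceAs (CompleteSpace (Completion (Cc Γ X U)))

variable {Γ X U}

/-- The canonical map `C_c(G) → C⋆(G)`. -/
def of (f : Cc Γ X U) : CStar Γ X U := (f : Completion (Cc Γ X U))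

theorem isDenseInducing_of : IsDenseInducing (of : Cc Γ X U → CStar Γ X U) :=
  Completion.isDenseInducing_coe

theorem continuous_of : Continuous (of : Cc Γ X U → CStar Γ X U) :=
  Completion.continuous_coe _

theorem of_add (f g : Cc Γ X U) : of (f + g) = of f + of g := Completion.coe_add f g
theorem of_zero : of (0 : Cc Γ X U) = 0 := Completion.coe_zero
theorem of_smul (c : ℂ) (f : Cc Γ X U) : of (c • f) = c • of f := Completion.coe_smul c f
theorem norm_of (f : Cc Γ X U) : ‖of f‖ = f.fullNorm := Completion.norm_coe f

@[elab_as_elim]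
theorem induction_on {P : CStar Γ X U → Prop} (a : CStar Γ X U) (hc : IsClosed {a | P a})
    (h : ∀ f, P (of f)) : P a :=
  Completion.induction_on a hc h

@[elab_as_elim]
theorem induction_on₂ {P : CStar Γ X U → CStar Γ X U → Prop} (a b : CStar Γ X U)
    (hc : IsClosed {x : CStar Γ X U × CStar Γ X U | P x.1 x.2}) (h : ∀ f g, P (of f) (of g)) :
    P a b :=
  Completion.induction_on₂ a b hc h

@[elab_as_elim]
theorem induction_on₃ {P : CStar Γ X U → CStar Γ X U → CStar Γ X U → Prop} (a b c : CStar Γ X U)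
    (hc : IsClosed {x : CStar Γ X U × CStar Γ X U × CStar Γ X U | P x.1 x.2.1 x.2.2})
    (h : ∀ f g e, P (of f) (of g) (of e)) : P a b c :=
  Completion.induction_on₃ a b c hc h

/-- The product is the continuous extension of convolution. -/
instance : Mul (CStar Γ X U) :=
  ⟨Function.curry <| (isDenseInducing_of.prodMap isDenseInducing_of).extend
    (of ∘ Function.uncurry (· * ·))⟩

theorem of_mul (f g : Cc Γ X U) : of (f * g) = of f * of g :=
  ((isDenseInducing_of.prodMap isDenseInducing_of).extend_eq
      (continuous_of.comp (continuous_mul (M := Cc Γ X U))) (f, g)).symm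

instance : ContinuousMul (CStar Γ X U) where
  continuous_mul := by
    let e : Cc Γ X U →+ CStar Γ X U := ⟨⟨of, of_zero⟩, of_add⟩
    let m := (AddMonoidHom.mul : Cc Γ X U →+ Cc Γ X U →+ Cc Γ X U).compr₂ e
    have : Continuous fun p : Cc Γ X U × Cc Γ X U => m p.1 p.2 :=
      continuous_of.comp continuous_mul
    have di : IsDenseInducing e := isDenseInducing_of
    exact (di.extend_Z_bilin di this :)

instance : NonUnitalNormedRing (CStar Γ X U) where
  __ := (inferInstance : NormedAddCommGroup (CStar Γ X U))
  left_distrib a b c := by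
    refine induction_on₃ a b c (isClosed_eq (by fun_prop) (by fun_prop)) fun f g h => ?_
    rw [← of_add, ← of_mul, ← of_mul, ← of_mul, ← of_add, mul_add]
  right_distrib a b c := by
    refine induction_on₃ a b c (isClosed_eq (by fun_prop) (by fun_prop)) fun f g h => ?_
    rw [← of_add, ← of_mul, ← of_mul, ← of_mul, ← of_add, add_mul]
  zero_mul a := by
    refine induction_on a (isClosed_eq (by fun_prop) (by fun_prop)) fun f => ?_
    rw [← of_zero, ← of_mul, zero_mul]
  mul_zero a := by
    refine induction_on a (isClosed_eq (by fun_prop) (by fun_prop)) fun f => ?_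
    rw [← of_zero, ← of_mul, mul_zero]
  mul_assoc a b c := by
    refine induction_on₃ a b c (isClosed_eq (by fun_prop) (by fun_prop)) fun f g h => ?_
    rw [← of_mul, ← of_mul, ← of_mul, ← of_mul, mul_assoc]
  norm_mul_le a b := by
    refine induction_on₂ a b (isClosed_le (by fun_prop) (by fun_prop)) fun f g => ?_
    rw [← of_mul, norm_of, norm_of, norm_of]
    exact f.fullNorm_mul_le g

/-- The involution is the continuous extension of the involution of `C_c(G)`. -/
instance : Star (CStar Γ X U) := ⟨Completion.map star⟩

theorem uniformContinuous_star : UniformContinuous (star : Cc Γ X U → Cc Γ X U) :=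
  uniformContinuous_addMonoidHom_of_continuous
    (f := (starAddEquiv : Cc Γ X U ≃+ Cc Γ X U).toAddMonoidHom) continuous_star

theorem of_star (f : Cc Γ X U) : of (star f) = star (of f) :=
  (Completion.map_coe uniformContinuous_star f).symm

theorem continuous_star' : Continuous (star : CStar Γ X U → CStar Γ X U) :=
  Completion.continuous_map

instance : StarRing (CStar Γ X U) where
  star_involutive a := by
    refine induction_on a (isClosed_eq (continuous_star'.comp continuous_star') continuous_id)
      fun f => ?_
    rw [← of_star, ← of_star, star_star]
  star_add a b := by
    refine induction_on₂ a b (isClosed_eq (continuous_star'.comp (by fun_prop))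
      ((continuous_star'.comp continuous_fst).add (continuous_star'.comp continuous_snd)))
      fun f g => ?_
    rw [← of_add, ← of_star, ← of_star, ← of_star, ← of_add, star_add]
  star_mul a b := by
    refine induction_on₂ a b (isClosed_eq (continuous_star'.comp (by fun_prop))
      ((continuous_star'.comp continuous_snd).mul (continuous_star'.comp continuous_fst)))
      fun f g => ?_
    rw [← of_mul, ← of_star, ← of_star, ← of_star, ← of_mul, star_mul]

theorem continuous_smul_left (c : ℂ) : Continuous (fun a : CStar Γ X U => c • a) :=
  continuous_const_smul c

instance : NonUnitalCStarAlgebra (CStar Γ X U) where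
  norm_mul_self_le a := by
    refine induction_on a (isClosed_le (by fun_prop)
      (continuous_norm.comp (continuous_star'.mul continuous_id))) fun f => ?_
    rw [← of_star, ← of_mul, norm_of, norm_of]
    exact f.sq_fullNorm_le
  smul_assoc c a b := by
    refine induction_on₂ a b (isClosed_eq
      (((continuous_smul_left c).comp continuous_fst).mul continuous_snd)
      ((continuous_smul_left c).comp continuous_mul)) fun f g => ?_
    simp only [smul_eq_mul]
    rw [← of_smul, ← of_mul, ← of_mul, ← of_smul, smul_mul_assoc]
  smul_comm c a b := by
    refine induction_on₂ a b (isClosed_eq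
      ((continuous_smul_left c).comp continuous_mul)
      (continuous_fst.mul ((continuous_smul_left c).comp continuous_snd))) fun f g => ?_
    simp only [smul_eq_mul]
    rw [← of_smul, ← of_mul, ← of_mul, ← of_smul, mul_smul_comm]
  star_smul c a := by
    refine induction_on a (isClosed_eq (continuous_star'.comp (continuous_smul_left c))
      ((continuous_smul_left _).comp continuous_star')) fun f => ?_
    rw [← of_smul, ← of_star, ← of_star, ← of_smul, star_smul]

/-- A ⋆-homomorphism on `C_c(G)` that is bounded by the `ℓ¹`-norm is contractive for the full
C⋆-norm. -/
theorem norm_le_fullNorm {B : Type} [NonUnitalCStarAlgebra B] (φ : Cc Γ X U →⋆ₙₐ[ℂ] B)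
    (h : ∀ f, ‖φ f‖ ≤ f.ellOne) (f : Cc Γ X U) : ‖φ f‖ ≤ f.fullNorm := by
  let q : Seminorm ℂ (Cc Γ X U) := Seminorm.ofSMulLE (fun f => ‖φ f‖) (by simp)
    (fun f g => by simpa using norm_add_le (φ f) (φ g)) (fun c f => by simp [norm_smul])
  have hq : Cc.IsCStarSeminorm q :=
    ⟨fun f g => by
        change ‖φ (f * g)‖ ≤ ‖φ f‖ * ‖φ g‖
        rw [map_mul]
        exact norm_mul_le _ _,
      fun f => by
        change ‖φ (star f * f)‖ = ‖φ f‖ ^ 2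
        rw [map_mul, map_star, CStarRing.norm_star_mul_self, pow_two], h⟩
  exact Cc.le_fullNorm hq f

/-- The continuous extension to `C⋆(G)` of a ⋆-homomorphism on `C_c(G)`. -/
def lift {B : Type} [NonUnitalCStarAlgebra B] (φ : Cc Γ X U →⋆ₙₐ[ℂ] B)
    (h : ∀ f, ‖φ f‖ ≤ f.ellOne) : CStar Γ X U →⋆ₙₐ[ℂ] B :=
  have hu : UniformContinuous φ := by
    refine AddMonoidHomClass.uniformContinuous_of_bound φ 1 fun f => ?_
    rw [one_mul]
    exact norm_le_fullNorm φ h f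
  have he : ∀ f, Completion.extension φ (of f) = φ f := Completion.extension_coe hu
  have hc : Continuous (Completion.extension φ : CStar Γ X U → B) := Completion.continuous_extension
  { toFun := Completion.extension φ
    map_zero' := by rw [← of_zero, he, map_zero]
    map_add' := fun a b => by
      refine induction_on₂ a b (isClosed_eq (by fun_prop) (by fun_prop)) fun f g => ?_
      rw [← of_add, he, he, he, map_add]
    map_mul' := fun a b => by
      refine induction_on₂ a b (isClosed_eq (by fun_prop) (by fun_prop)) fun f g => ?_
      rw [← of_mul, he, he, he, map_mul]
    map_smul' := fun c a => by
      refine induction_on a (isClosed_eq (hc.comp (continuous_smul_left c)) (hc.const_smul c))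
        fun f => ?_
      rw [← of_smul, he, he]
      exact map_smul φ c f
    map_star' := fun a => by
      refine induction_on a (isClosed_eq (hc.comp continuous_star') hc.star) fun f => ?_
      rw [← of_star, he, he, map_star] }

theorem lift_of {B : Type} [NonUnitalCStarAlgebra B] (φ : Cc Γ X U →⋆ₙₐ[ℂ] B)
    (h : ∀ f, ‖φ f‖ ≤ f.ellOne) (f : Cc Γ X U) : lift φ h (of f) = φ f := by
  have hu : UniformContinuous φ := by
    refine AddMonoidHomClass.uniformContinuous_of_bound φ 1 fun f => ?_
    rw [one_mul]
    exact norm_le_fullNorm φ h f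
  exact Completion.extension_coe hu f

end CStar
end Groupoid

/-- The Hilbert space `ℓ²(ι)`. -/
abbrev EllTwo (ι : Type) : Type := lp (fun _ : ι => ℂ) 2

/-- The arrows of the groupoid with source `y`, identified with the `k` such that `k • y ∈ U`. -/
abbrev Fiber {X : Type} (U : Set X) (Γ : Type) [Group Γ] [MulAction Γ X] (y : X) : Type :=
  {k : Γ // k • y ∈ U}

section Representations

variable {Γ X : Type} [Group Γ] [TopologicalSpace X] [MulAction Γ X] {U : Set X}

/-! ### Time evolutions given by characters of `Γ` -/

variable [ContinuousConstSMul Γ X]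

namespace Cc

theorem twist_mem (χ : Γ →* Circle) (f : Cc Γ X U) :
    (fun k x => (χ k : ℂ) * f k x) ∈ ccSubmodule Γ X U := by
  refine ⟨f.2.1.subset fun k hk h => hk ?_, fun k => ⟨continuous_const.mul (f.2.2 k).1,
    (f.2.2 k).2.1.mul_left, ?_⟩⟩
  · funext x
    simp [h]
  · exact (tsupport_mul_subset_right (f := fun _ => (χ k : ℂ))).trans (f.2.2 k).2.2

/-- The ⋆-endomorphism `f(k, x) ↦ χ(k) f(k, x)` of `C_c(G)`. -/
def twist (χ : Γ →* Circle) : Cc Γ X U →⋆ₙₐ[ℂ] Cc Γ X U where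
  toFun f := ⟨fun k x => (χ k : ℂ) * f k x, twist_mem χ f⟩
  map_smul' c f := by
    ext k x
    change (χ k : ℂ) * (c * f k x) = c * ((χ k : ℂ) * f k x)
    ring
  map_zero' := by
    ext k x
    exact mul_zero _
  map_add' f g := by
    ext k x
    exact mul_add _ _ _
  map_mul' f g := by
    ext k x
    change (χ k : ℂ) * act f x (fun s => g s x) k =
      ∑ᶠ s, ((χ (k * s⁻¹) : ℂ) * f (k * s⁻¹) (s • x)) * ((χ s : ℂ) * g s x)
    unfold act
    rw [← smul_eq_mul, smul_finsum]
    refine finsum_congr fun s => ?_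
    have : (χ k : ℂ) = χ (k * s⁻¹) * χ s := by rw [← Circle.coe_mul, ← map_mul]; simp
    rw [this, smul_eq_mul]
    ring
  map_star' f := by
    ext k x
    change (χ k : ℂ) * conj (f k⁻¹ (k • x)) = conj ((χ k⁻¹ : ℂ) * f k⁻¹ (k • x))
    rw [map_mul, map_inv, Circle.coe_inv_eq_conj, Complex.conj_conj]

theorem ellOne_le {f : Cc Γ X U} {S : Finset Γ} {C : Γ → ℝ} (hS : f.supp ⊆ S)
    (hC : ∀ k, 0 ≤ C k) (h : ∀ k x, ‖f k x‖ ≤ C k) : f.ellOne ≤ ∑ k ∈ S, C k :=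
  (Finset.sum_le_sum fun k _ => Real.iSup_le (h k) (hC k)).trans
    (Finset.sum_le_sum_of_subset_of_nonneg hS fun k _ _ => hC k)

theorem ellOne_twist_le (χ : Γ →* Circle) (f : Cc Γ X U) : (twist χ f).ellOne ≤ f.ellOne := by
  refine ellOne_le (fun k hk => ?_) f.iSup_nonneg fun k x => ?_
  · by_contra h
    have h0 : twist χ f k = 0 := by
      funext x
      change (χ k : ℂ) * f k x = 0
      simp [f.eq_zero_of_notMem h]
    simp [supp, h0] at hk
  · change ‖(χ k : ℂ) * f k x‖ ≤ _
    rw [norm_mul, Circle.norm_coe, one_mul]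
    exact f.norm_le_iSup k x

end Cc

namespace CStar

/-- The canonical map `C_c(G) → C⋆(G)` as a ⋆-homomorphism. -/
def ofHom : Cc Γ X U →⋆ₙₐ[ℂ] CStar Γ X U where
  toFun := of
  map_smul' := of_smul
  map_zero' := of_zero
  map_add' := of_add
  map_mul' := of_mul
  map_star' := of_star

theorem norm_ofHom_twist_le (χ : Γ →* Circle) (f : Cc Γ X U) :
    ‖((ofHom : Cc Γ X U →⋆ₙₐ[ℂ] CStar Γ X U).comp (Cc.twist χ)) f‖ ≤ f.ellOne := by
  change ‖of (Cc.twist χ f)‖ ≤ f.ellOne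
  rw [norm_of]
  exact (Cc.fullNorm_le_ellOne _).trans (Cc.ellOne_twist_le χ f)

/-- The ⋆-endomorphism of `C⋆(G)` that extends `f(k, x) ↦ χ(k) f(k, x)`. -/
def twist (χ : Γ →* Circle) : CStar Γ X U →⋆ₙₐ[ℂ] CStar Γ X U :=
  lift (ofHom.comp (Cc.twist χ)) (norm_ofHom_twist_le χ)

theorem twist_of (χ : Γ →* Circle) (f : Cc Γ X U) : twist χ (of f) = of (Cc.twist χ f) :=
  lift_of (ofHom.comp (Cc.twist χ)) (norm_ofHom_twist_le χ) f

end CStar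

/-! ### The regular representations -/

/-- Extension of a vector in `ℓ²(G_y)` by zero. -/
def extZero {y : X} (ξ : EllTwo (Fiber U Γ y)) : Γ → ℂ :=
  Function.extend Subtype.val (fun k => ξ k) 0

theorem extZero_coe {y : X} (ξ : EllTwo (Fiber U Γ y)) (k : Fiber U Γ y) : extZero ξ k = ξ k :=
  Subtype.val_injective.extend_apply _ _ _

theorem extZero_of_notMem {y : X} (ξ : EllTwo (Fiber U Γ y)) {k : Γ} (hk : k • y ∉ U) :
    extZero ξ k = 0 :=
  Function.extend_apply' _ _ _ (by rintro ⟨s, rfl⟩; exact hk s.2)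

theorem extZero_add {y : X} (ξ η : EllTwo (Fiber U Γ y)) :
    extZero (ξ + η) = extZero ξ + extZero η := by
  funext k
  by_cases hk : k • y ∈ U
  · have := fun ζ : EllTwo (Fiber U Γ y) => extZero_coe ζ ⟨k, hk⟩
    simp only at this
    simp [this]
  · simp [extZero_of_notMem _ hk]

theorem extZero_smul {y : X} (c : ℂ) (ξ : EllTwo (Fiber U Γ y)) :
    extZero (c • ξ) = c • extZero ξ := by
  funext k
  by_cases hk : k • y ∈ U
  · have := fun ζ : EllTwo (Fiber U Γ y) => extZero_coe ζ ⟨k, hk⟩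
    simp only at this
    simp [this]
  · simp [extZero_of_notMem _ hk]

theorem hasSum_sq_extZero {y : X} (ξ : EllTwo (Fiber U Γ y)) :
    HasSum (fun k => ‖extZero ξ k‖ ^ 2) (‖ξ‖ ^ 2) := by
  have h : (fun k => ‖extZero ξ k‖ ^ 2) =
      Function.extend Subtype.val (fun k : Fiber U Γ y => ‖ξ k‖ ^ 2) 0 := by
    funext k
    by_cases hk : k • y ∈ U
    · rw [show k = (⟨k, hk⟩ : Fiber U Γ y).1 from rfl, Subtype.val_injective.extend_apply,
        extZero_coe]
    · rw [extZero_of_notMem _ hk, Function.extend_apply' _ _ _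
        (by rintro ⟨s, rfl⟩; exact hk s.2)]
      simp
  rw [h, hasSum_extend_zero Subtype.val_injective]
  simpa using lp.hasSum_norm (p := 2) (by simp) ξ

theorem memℓp_shift {y : X} (f : Cc Γ X U) (g : Γ) (ξ : EllTwo (Fiber U Γ y)) :
    Memℓp (fun k : Fiber U Γ y => f g ((g⁻¹ * k.1) • y) * extZero ξ (g⁻¹ * k.1)) 2 ∧
    ∀ h : Memℓp (fun k : Fiber U Γ y => f g ((g⁻¹ * k.1) • y) * extZero ξ (g⁻¹ * k.1)) 2,
      ‖(⟨_, h⟩ : EllTwo (Fiber U Γ y))‖ ≤ (⨆ x, ‖f g x‖) * ‖ξ‖ := by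
  set C := ⨆ x, ‖f g x‖
  have hinj : Function.Injective fun k : Fiber U Γ y => g⁻¹ * k.1 :=
    fun a b h => Subtype.ext (mul_left_cancel h)
  have hs : Summable fun k : Fiber U Γ y => C ^ 2 * ‖extZero ξ (g⁻¹ * k.1)‖ ^ 2 :=
    ((hasSum_sq_extZero ξ).summable.comp_injective hinj).mul_left _
  have hle : ∀ k : Fiber U Γ y, ‖f g ((g⁻¹ * k.1) • y) * extZero ξ (g⁻¹ * k.1)‖ ^ 2 ≤
      C ^ 2 * ‖extZero ξ (g⁻¹ * k.1)‖ ^ 2 := fun k => by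
    rw [norm_mul, mul_pow]
    gcongr
    exact f.norm_le_iSup g _
  have hm := Summable.of_nonneg_of_le (fun _ => by positivity) hle hs
  refine ⟨memℓp_gen (by simpa using hm), fun h => ?_⟩
  refine abs_le_of_sq_le_sq' ?_ (mul_nonneg (f.iSup_nonneg g) (norm_nonneg _)) |>.2
  have h1 := lp.hasSum_norm (p := 2) (by simp) (⟨_, h⟩ : EllTwo (Fiber U Γ y))
  have h2 : HasSum (fun k : Fiber U Γ y => ‖f g ((g⁻¹ * k.1) • y) * extZero ξ (g⁻¹ * k.1)‖ ^ 2)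
      (‖(⟨_, h⟩ : EllTwo (Fiber U Γ y))‖ ^ 2) := by simpa using h1
  rw [mul_pow, ← (hasSum_sq_extZero ξ).tsum_eq, ← tsum_mul_left, ← h2.tsum_eq]
  refine (hm.tsum_le_tsum hle hs).trans ?_
  exact tsum_comp_le_tsum_of_inj ((hasSum_sq_extZero ξ).summable.mul_left _)
    (fun _ => by positivity) hinj

theorem memℓp_act {y : X} (f : Cc Γ X U) (ξ : EllTwo (Fiber U Γ y)) :
    Memℓp (fun k : Fiber U Γ y => act f y (extZero ξ) k.1) 2 := by
  have h : (fun k : Fiber U Γ y => act f y (extZero ξ) k.1) =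
      (∑ g ∈ f.supp, (⟨_, (memℓp_shift f g ξ).1⟩ : EllTwo (Fiber U Γ y)) :
        EllTwo (Fiber U Γ y)) := by
    funext k
    rw [lp.coeFn_sum, Finset.sum_apply]
    exact f.act_eq_sum (le_refl _) y _ k.1
  rw [h]
  exact lp.memℓp _

theorem norm_act_le {y : X} (f : Cc Γ X U) (ξ : EllTwo (Fiber U Γ y)) :
    ‖(⟨_, memℓp_act f ξ⟩ : EllTwo (Fiber U Γ y))‖ ≤ f.ellOne * ‖ξ‖ := by
  have h : (⟨_, memℓp_act f ξ⟩ : EllTwo (Fiber U Γ y)) =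
      ∑ g ∈ f.supp, (⟨_, (memℓp_shift f g ξ).1⟩ : EllTwo (Fiber U Γ y)) := by
    ext k
    rw [lp.coeFn_sum, Finset.sum_apply]
    exact f.act_eq_sum (le_refl _) y _ k.1
  rw [h, Cc.ellOne, Finset.sum_mul]
  exact (norm_sum_le _ _).trans (Finset.sum_le_sum fun g _ => (memℓp_shift f g ξ).2 _)

/-- Left convolution by `f ∈ C_c(G)` on `ℓ²(G_y)`:
`(π_y(f) ξ)(γ) = ∑ f(γ₁) ξ(γ₂)` over `γ₁ γ₂ = γ`. -/
def regOp (y : X) (f : Cc Γ X U) : EllTwo (Fiber U Γ y) →L[ℂ] EllTwo (Fiber U Γ y) :=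
  LinearMap.mkContinuous
    { toFun := fun ξ => ⟨fun k => act f y (extZero ξ) k.1, memℓp_act f ξ⟩
      map_add' := fun ξ η => by
        ext k
        change act f y (extZero (ξ + η)) k.1 = act f y (extZero ξ) k.1 + act f y (extZero η) k.1
        rw [extZero_add, f.act_add_right]
      map_smul' := fun c ξ => by
        ext k
        change act f y (extZero (c • ξ)) k.1 = c * act f y (extZero ξ) k.1
        rw [extZero_smul, f.act_smul_right] }
    f.ellOne (norm_act_le f)

theorem regOp_apply (y : X) (f : Cc Γ X U) (ξ : EllTwo (Fiber U Γ y)) (k : Fiber U Γ y) :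
    regOp y f ξ k = act f y (extZero ξ) k.1 := rfl

theorem norm_regOp_le (y : X) (f : Cc Γ X U) : ‖regOp y f‖ ≤ f.ellOne :=
  LinearMap.mkContinuous_norm_le _ f.ellOne_nonneg _

theorem extZero_regOp (y : X) (f : Cc Γ X U) (ξ : EllTwo (Fiber U Γ y)) :
    extZero (regOp y f ξ) = act f y (extZero ξ) := by
  funext k
  by_cases hk : k • y ∈ U
  · exact extZero_coe (regOp y f ξ) ⟨k, hk⟩
  · rw [extZero_of_notMem _ hk, f.act_eq_zero y _ hk]

theorem hasSum_inner_extZero {y : X} (ξ η : EllTwo (Fiber U Γ y)) :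
    HasSum (fun k => conj (extZero ξ k) * extZero η k) (inner ℂ ξ η) := by
  have h : (fun k => conj (extZero ξ k) * extZero η k) =
      Function.extend Subtype.val (fun k : Fiber U Γ y => inner ℂ (ξ k) (η k)) 0 := by
    funext k
    by_cases hk : k • y ∈ U
    · rw [show k = (⟨k, hk⟩ : Fiber U Γ y).1 from rfl, Subtype.val_injective.extend_apply,
        extZero_coe, extZero_coe]
      simp [mul_comm]
    · rw [extZero_of_notMem _ hk, Function.extend_apply' _ _ _
        (by rintro ⟨s, rfl⟩; exact hk s.2)]
      simp
  rw [h, hasSum_extend_zero Subtype.val_injective]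
  exact lp.hasSum_inner ξ η

theorem regOp_star (y : X) (f : Cc Γ X U) :
    regOp y (star f) = ContinuousLinearMap.adjoint (regOp y f) := by
  rw [ContinuousLinearMap.eq_adjoint_iff]
  intro η ξ
  set u := extZero η
  set v := extZero ξ
  have hstar : ∀ k, act (star f : Cc Γ X U) y u k =
      ∑ g ∈ f.supp, conj (f g (k • y)) * u (g * k) := by
    intro k
    unfold act
    rw [← finsum_comp_equiv (Equiv.mulRight k)]
    rw [finsum_eq_sum_of_support_subset (s := f.supp)]
    · refine Finset.sum_congr rfl fun g _ => ?_
      simp [Cc.star_apply, smul_smul]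
    · intro g hg
      by_contra h
      exact hg (by simp [Cc.star_apply, f.eq_zero_of_notMem h])
  have hsum : ∀ g, Summable fun k => f g (k • y) * (conj (u (g * k)) * v k) := by
    intro g
    have h1 : Summable fun k => ‖u (g * k)‖ ^ 2 + ‖v k‖ ^ 2 :=
      ((hasSum_sq_extZero η).summable.comp_injective (mul_right_injective g)).add
        (hasSum_sq_extZero ξ).summable
    refine Summable.of_norm_bounded (h1.mul_left (⨆ x, ‖f g x‖)) fun k => ?_
    rw [norm_mul, norm_mul, RCLike.norm_conj]
    refine mul_le_mul (f.norm_le_iSup g _) ?_ (by positivity) (f.iSup_nonneg g)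
    nlinarith [sq_nonneg (‖u (g * k)‖ - ‖v k‖), sq_nonneg ‖u (g * k)‖, sq_nonneg ‖v k‖]
  have h1 : HasSum (fun k => ∑ g ∈ f.supp, f g (k • y) * (conj (u (g * k)) * v k))
      (∑ g ∈ f.supp, ∑' k, f g (k • y) * (conj (u (g * k)) * v k)) :=
    hasSum_sum fun g _ => (hsum g).hasSum
  have h2 : HasSum (fun k => ∑ g ∈ f.supp,
      f g ((g⁻¹ * k) • y) * (conj (u (g * (g⁻¹ * k))) * v (g⁻¹ * k)))
      (∑ g ∈ f.supp, ∑' k, f g (k • y) * (conj (u (g * k)) * v k)) :=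
    hasSum_sum fun g _ => by
      have h3 : HasSum ((fun k => f g (k • y) * (conj (u (g * k)) * v k)) ∘ Equiv.mulLeft g⁻¹)
          (∑' k, f g (k • y) * (conj (u (g * k)) * v k)) :=
        (Equiv.hasSum_iff _).mpr (hsum g).hasSum
      simpa only [Function.comp_def, Equiv.coe_mulLeft] using h3
  have h1' : (fun k => conj (extZero (regOp y (star f) η) k) * extZero ξ k) =
      fun k => ∑ g ∈ f.supp, f g (k • y) * (conj (u (g * k)) * v k) := by
    funext k
    rw [extZero_regOp, hstar, map_sum, Finset.sum_mul]
    refine Finset.sum_congr rfl fun g _ => ?_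
    rw [map_mul, Complex.conj_conj, mul_assoc]
  have h2' : (fun k => conj (extZero η k) * extZero (regOp y f ξ) k) =
      fun k => ∑ g ∈ f.supp,
        f g ((g⁻¹ * k) • y) * (conj (u (g * (g⁻¹ * k))) * v (g⁻¹ * k)) := by
    funext k
    rw [extZero_regOp, f.act_eq_sum (le_refl _), Finset.mul_sum]
    refine Finset.sum_congr rfl fun g _ => ?_
    rw [mul_inv_cancel_left]
    ring
  have e1 := hasSum_inner_extZero (regOp y (star f) η) ξ
  have e2 := hasSum_inner_extZero η (regOp y f ξ)
  rw [h1'] at e1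
  rw [h2'] at e2
  exact (e1.unique h1).trans (e2.unique h2).symm

/-- The representation `π_y` of `C_c(G)`. -/
def regRepCc (y : X) :
    Cc Γ X U →⋆ₙₐ[ℂ] (EllTwo (Fiber U Γ y) →L[ℂ] EllTwo (Fiber U Γ y)) where
  toFun := regOp y
  map_smul' c f := by
    ext ξ k
    exact Cc.act_smul_left c f y _ k.1
  map_zero' := by
    ext ξ k
    have := Cc.act_smul_left 0 (0 : Cc Γ X U) y (extZero ξ) k.1
    rw [zero_smul, zero_mul] at this
    exact this
  map_add' f g := by
    ext ξ k
    exact Cc.act_add_left f g y _ k.1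
  map_mul' f g := by
    ext ξ k
    change act (f * g : Cc Γ X U) y (extZero ξ) k.1 = act f y (extZero (regOp y g ξ)) k.1
    rw [Cc.act_mul, extZero_regOp]
  map_star' f := regOp_star y f

theorem regRepCc_apply (y : X) (f : Cc Γ X U) : regRepCc y f = regOp y f := rfl

theorem norm_regRepCc_le (y : X) (f : Cc Γ X U) : ‖regRepCc y f‖ ≤ f.ellOne := by
  rw [regRepCc_apply]
  exact norm_regOp_le y f

/-- The representation `π_y` of `C⋆(G)` on `ℓ²(G_y)`. -/
def regRep (y : X) :
    CStar Γ X U →⋆ₙₐ[ℂ] (EllTwo (Fiber U Γ y) →L[ℂ] EllTwo (Fiber U Γ y)) :=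
  CStar.lift (B := EllTwo (Fiber U Γ y) →L[ℂ] EllTwo (Fiber U Γ y)) (regRepCc y)
    (norm_regRepCc_le y)

theorem regRep_of (y : X) (f : Cc Γ X U) : regRep y (CStar.of f) = regOp y f :=
  CStar.lift_of (B := EllTwo (Fiber U Γ y) →L[ℂ] EllTwo (Fiber U Γ y)) (regRepCc y)
    (norm_regRepCc_le y) f

end Representations

/-! ### Unbounded operators, Hamiltonians, traces and the KMS condition -/

section Operators

variable {E : Type} [NormedAddCommGroup E] [InnerProductSpace ℂ E]

/-- The spectrum of a (possibly unbounded) operator `T`: the complement of the set of `z` for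
which `T - z` has a bounded everywhere defined two-sided inverse. -/
def unboundedSpectrum (T : E →ₗ.[ℂ] E) : Set ℂ :=
  {z | ¬ ∃ R : E →L[ℂ] E, (∀ ξ, ∃ h : R ξ ∈ T.domain, T ⟨R ξ, h⟩ - z • R ξ = ξ) ∧
    ∀ ξ : T.domain, R (T ξ - z • (ξ : E)) = ξ}

/-- `U` is a strongly continuous one-parameter unitary group. -/
structure IsUnitaryGroup [CompleteSpace E] (U : ℝ → E →L[ℂ] E) : Prop where
  mem_unitary : ∀ t, U t ∈ unitary (E →L[ℂ] E)
  zero : U 0 = 1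
  add : ∀ s t, U (s + t) = U s * U t
  continuous : ∀ ξ, Continuous fun t => U t ξ

/-- `U t = e^{itT}`: `U` is a strongly continuous one-parameter unitary group whose generator,
in the sense of Stone's theorem, is `T`. -/
structure IsExpOf [CompleteSpace E] (U : ℝ → E →L[ℂ] E) (T : E →ₗ.[ℂ] E) : Prop
    extends IsUnitaryGroup U where
  generator : ∀ ξ η, (ξ, η) ∈ T.graph ↔ HasDerivAt (fun t => U t ξ) (Complex.I • η) 0

/-- The operator `T` is a Hamiltonian for the time evolution `σ` in the representation `π`: it is
self-adjoint and `π(σ_t(a)) = e^{itT} π(a) e^{-itT}`. -/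
def IsHamiltonian [CompleteSpace E] {A : Type} (σ : ℝ → A → A) (π : A → E →L[ℂ] E)
    (T : E →ₗ.[ℂ] E) : Prop :=
  IsSelfAdjoint T ∧ ∃ U : ℝ → E →L[ℂ] E, IsExpOf U T ∧
    ∀ t a, π (σ t a) = U t * π a * U (-t)

/-- The representation `π` has positive energy, with Hamiltonian `T`: the operator `T` implements
the time evolution and is nonnegative. -/
def IsPositiveEnergy [CompleteSpace E] {A : Type} (σ : ℝ → A → A) (π : A → E →L[ℂ] E)
    (T : E →ₗ.[ℂ] E) : Prop :=
  IsHamiltonian σ π T ∧ ∀ ξ : T.domain, 0 ≤ (inner ℂ (ξ : E) (T ξ)).re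

/-- The bounded operator `T` is of trace class with trace `c`: in every orthonormal basis the
diagonal of `T` is (absolutely) summable, with sum `c`. -/
def HasTrace (T : E →L[ℂ] E) (c : ℂ) : Prop :=
  ∀ (ι : Type) (b : HilbertBasis ι ℂ E), HasSum (fun i => inner ℂ (b i) (T (b i))) c

/-- The KMS condition at inverse temperature `β` for a functional `ψ` and a time evolution `σ`:
for all `a, b` there is a bounded continuous function `F` on the strip `0 ≤ Im z ≤ β`, holomorphic
inside, with `F(t) = ψ(a σ_t(b))` and `F(t + iβ) = ψ(σ_t(b) a)`. -/
def IsKMS {A : Type} [Mul A] (σ : ℝ → A → A) (β : ℝ) (ψ : A → ℂ) : Prop :=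
  ∀ a b : A, ∃ F : ℂ → ℂ,
    ContinuousOn F {z | 0 ≤ z.im ∧ z.im ≤ β} ∧
    DifferentiableOn ℂ F {z | 0 < z.im ∧ z.im < β} ∧
    (∃ C : ℝ, ∀ z : ℂ, 0 ≤ z.im → z.im ≤ β → ‖F z‖ ≤ C) ∧
    (∀ t : ℝ, F t = ψ (a * σ t b)) ∧
    ∀ t : ℝ, F (t + Complex.I * β) = ψ (σ t b * a)

variable {ι : Type}

/-- The multiplication operator `ξ ↦ h ξ` on `ℓ²(ι)` with its maximal domain. -/
def mulOp (h : ι → ℂ) : EllTwo ι →ₗ.[ℂ] EllTwo ι where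
  domain :=
    { carrier := {ξ | Memℓp (fun i => h i * ξ i) 2}
      zero_mem' := by
        change Memℓp (fun i => h i * (0 : EllTwo ι) i) 2
        have : (fun i => h i * (0 : EllTwo ι) i) = 0 := by
          funext i
          simp
        rw [this]
        exact zero_memℓp
      add_mem' := fun {ξ η} hξ hη => by
        have : (fun i => h i * (ξ + η) i) = (fun i => h i * ξ i) + fun i => h i * η i := by
          funext i
          simp [mul_add]
        change Memℓp (fun i => h i * (ξ + η) i) 2
        rw [this]
        exact Memℓp.add hξ hη
      smul_mem' := fun c ξ hξ => by
        have : (fun i => h i * (c • ξ) i) = c • fun i => h i * ξ i := by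
          funext i
          simp [mul_left_comm]
        change Memℓp (fun i => h i * (c • ξ) i) 2
        rw [this]
        exact Memℓp.const_smul hξ c }
  toFun :=
    { toFun := fun ξ => ⟨fun i => h i * ξ.1 i, ξ.2⟩
      map_add' := fun ξ η => by
        ext i
        exact mul_add _ _ _
      map_smul' := fun c ξ => by
        ext i
        exact mul_left_comm _ _ _ }

open Classical in
/-- The bounded operator that equals `mulOp h`; it is `0` in the case that `mulOp h` is not a
bounded everywhere defined operator. -/
def boundedMulOp (h : ι → ℂ) : EllTwo ι →L[ℂ] EllTwo ι :=
  if H : ∃ T : EllTwo ι →L[ℂ] EllTwo ι, (T : EllTwo ι →ₗ[ℂ] EllTwo ι).toPMap ⊤ = mulOp h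
  then H.choose else 0

end Operators

/-! ### The system attached to a prime number -/

section Adeles

open NumberField IsDedekindDomain

variable (p : ℕ) [Fact p.Prime]

/-- The place of `ℚ` at `p`. -/
def place : HeightOneSpectrum ℤ :=
  Rat.HeightOneSpectrum.primesEquiv.symm ⟨p, Fact.out⟩

/-- The adeles of `ℚ` whose component at `p` vanishes. -/
def AdeleAt : Type := {a : AdeleRing ℤ ℚ // a.2 (place p) = 0}

instance : TopologicalSpace (AdeleAt p) :=
  inferInstanceAs (TopologicalSpace {a : AdeleRing ℤ ℚ // a.2 (place p) = 0})

/-- The multiplicative group of `ℚ` acts by multiplication. -/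
instance : MulAction ℚˣ (AdeleAt p) where
  smul k a := ⟨algebraMap ℚ (AdeleRing ℤ ℚ) k * a.1, by
    change (algebraMap ℚ (AdeleRing ℤ ℚ) k).2 (place p) * a.1.2 (place p) = 0
    rw [a.2, mul_zero]⟩
  one_smul a := Subtype.ext (by
    change algebraMap ℚ (AdeleRing ℤ ℚ) (1 : ℚˣ) * a.1 = a.1
    simp)
  mul_smul k l a := Subtype.ext (by
    change algebraMap ℚ (AdeleRing ℤ ℚ) (k * l : ℚˣ) * a.1 =
      algebraMap ℚ (AdeleRing ℤ ℚ) k * (algebraMap ℚ (AdeleRing ℤ ℚ) l * a.1)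
    simp [mul_assoc])

instance : ContinuousConstSMul ℚˣ (AdeleAt p) where
  continuous_const_smul _ :=
    Continuous.subtype_mk (continuous_const.mul continuous_subtype_val) _

variable {p} in
/-- The absolute value of the archimedean component. -/
def absInf (a : AdeleAt p) : ℝ := ‖a.1.1 Rat.infinitePlace‖

/-- The open set of the `a` with `|a_∞| < 1` and `|a_w| ≤ 1` at every finite place `w`; it is the
space of units of the groupoid. -/
def openBox : Set (AdeleAt p) :=
  {a | absInf a < 1 ∧ ∀ w : HeightOneSpectrum ℤ, Valued.v (a.1.2 w) ≤ 1}

/-- The set of the `a` with `|a_w| = 1` at every finite place `w ≠ p` and `p⁻¹ ≤ |a_∞| < 1`. -/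
def unitBox : Set (AdeleAt p) :=
  {a | (∀ w : HeightOneSpectrum ℤ, w ≠ place p → Valued.v (a.1.2 w) = 1) ∧
    (p : ℝ)⁻¹ ≤ absInf a ∧ absInf a < 1}

/-- The C⋆-algebra of the groupoid of the `(k, x)`, `k ∈ ℚˣ`, such that `x` and `k x` are in
`openBox p`. -/
abbrev Alg : Type := CStar ℚˣ (AdeleAt p) (openBox p)

variable {p} in
/-- The fiber of the groupoid over `y`. -/
abbrev Orbit (y : AdeleAt p) : Type := Fiber (openBox p) ℚˣ y

/-- The function `k ↦ log |k|_p`. -/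
def logAbs (k : ℚˣ) : ℝ := Real.log (padicNorm p (k : ℚ) : ℝ)

theorem logAbs_mul (k l : ℚˣ) : logAbs p (k * l) = logAbs p k + logAbs p l := by
  unfold logAbs
  rw [Units.val_mul, padicNorm.mul, Rat.cast_mul, Real.log_mul]
  · exact_mod_cast padicNorm.nonzero k.ne_zero
  · exact_mod_cast padicNorm.nonzero l.ne_zero

/-- The character `k ↦ |k|_p^{it}`. -/
def timeChar (t : ℝ) : ℚˣ →* Circle where
  toFun k := Circle.exp (t * logAbs p k)
  map_one' := by simp [logAbs]
  map_mul' k l := by rw [logAbs_mul, mul_add, Circle.exp_add]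

/-- The time evolution `σ_t(f)(k, x) = |k|_p^{it} f(k, x)`. -/
def evolution (t : ℝ) : Alg p →⋆ₙₐ[ℂ] Alg p := CStar.twist (timeChar p t)

variable {p}

/-- The representation `π_y`. -/
def rep (y : AdeleAt p) : Alg p →⋆ₙₐ[ℂ] (EllTwo (Orbit y) →L[ℂ] EllTwo (Orbit y)) := regRep y

/-- The Hamiltonian `(H_y ξ)(k, y) = log |k|_p ξ(k, y)`. -/
def hamiltonian (y : AdeleAt p) : EllTwo (Orbit y) →ₗ.[ℂ] EllTwo (Orbit y) :=
  mulOp fun k => (logAbs p k.1 : ℂ)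

/-- The bounded operator `e^{-βH_y}`. -/
def expNegHamiltonian (β : ℝ) (y : AdeleAt p) : EllTwo (Orbit y) →L[ℂ] EllTwo (Orbit y) :=
  boundedMulOp fun k => (Real.exp (-β * logAbs p k.1) : ℂ)

end Adeles

/-! ### Digits -/

/-- The digits `c_k`, `k ≥ 0`, of the expansion `lam = ∑ c_k p^{-k}` of `lam ∈ (1, p]` in base
`p`; if there are two expansions, the one that does not terminate is meant. -/
def digit (p : ℕ) (lam : ℝ) (k : ℕ) : ℤ :=
  ⌈lam * (p : ℝ) ^ (k : ℤ) - 1⌉ - p * ⌈lam * (p : ℝ) ^ ((k : ℤ) - 1) - 1⌉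

/-- The function `f_p(lam, β) = ∑ c_k p^{-kβ}`. -/
def digitSum (p : ℕ) (lam β : ℝ) : ℝ := ∑' k : ℕ, (digit p lam k : ℝ) * (p : ℝ) ^ (-(k * β))

/-- The function `2 (1 - p^{-β}) / (1 - p^{1-β}) f_p(lam, β)`. -/
def partitionFunction (p : ℕ) (lam β : ℝ) : ℝ :=
  2 * ((1 - (p : ℝ) ^ (-β)) / (1 - (p : ℝ) ^ (1 - β))) * digitSum p lam β

theorem digit_mem (p : ℕ) (hp : 2 ≤ p) (lam : ℝ) (k : ℕ) :
    0 ≤ digit p lam k ∧ digit p lam k ≤ p - 1 := by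
  have hp0 : (0 : ℝ) < p := by positivity
  have e : lam * (p : ℝ) ^ (k : ℤ) = p * (lam * (p : ℝ) ^ ((k : ℤ) - 1)) := by
    rw [zpow_sub_one₀ hp0.ne']
    field_simp
  unfold digit
  rw [e]
  set x := lam * (p : ℝ) ^ ((k : ℤ) - 1)
  have h1 := Int.le_ceil (x - 1)
  have h2 := Int.ceil_lt_add_one (x - 1)
  set n := ⌈x - 1⌉
  have a1 : (p : ℤ) * n - 1 < ⌈(p : ℝ) * x - 1⌉ := by
    rw [Int.lt_ceil]
    push_cast
    nlinarith
  have a2 : ⌈(p : ℝ) * x - 1⌉ ≤ (p : ℤ) * n + p - 1 := by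
    rw [Int.ceil_le]
    push_cast
    nlinarith
  constructor <;> linarith

theorem sum_digit (p : ℕ) (hp : 2 ≤ p) (lam : ℝ) (h1 : 1 < lam) (h2 : lam ≤ p) (n : ℕ) :
    ∑ k ∈ Finset.range (n + 1), (digit p lam k : ℝ) * (p : ℝ) ^ (-(k : ℤ)) =
      ⌈lam * (p : ℝ) ^ (n : ℤ) - 1⌉ * (p : ℝ) ^ (-(n : ℤ)) := by
  have hp0 : (0 : ℝ) < p := by positivity
  induction n with
  | zero =>
    have : ⌈lam * (p : ℝ) ^ ((0 : ℤ) - 1) - 1⌉ = 0 := by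
      rw [Int.ceil_eq_iff]
      have : 0 < lam / p := by positivity
      have : lam / p ≤ 1 := (div_le_one hp0).mpr h2
      simp only [zero_sub, zpow_neg_one, ← div_eq_mul_inv]
      push_cast
      constructor <;> linarith
    simp only [zero_add, Finset.sum_range_one, digit, CharP.cast_eq_zero, this]
    simp
  | succ n ih =>
    rw [Finset.sum_range_succ, ih, digit]
    have : ((n + 1 : ℕ) : ℤ) - 1 = n := by push_cast; ring
    rw [this]
    have e : (p : ℝ) ^ (-(n : ℤ)) = p * (p : ℝ) ^ (-((n + 1 : ℕ) : ℤ)) := by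
      rw [← zpow_one_add₀ hp0.ne']
      congr 1
      push_cast
      ring
    rw [e]
    push_cast
    ring

theorem hasSum_digit (p : ℕ) (hp : 2 ≤ p) (lam : ℝ) (h1 : 1 < lam) (h2 : lam ≤ p) :
    HasSum (fun k : ℕ => (digit p lam k : ℝ) * (p : ℝ) ^ (-(k : ℤ))) lam := by
  have hp0 : (0 : ℝ) < p := by positivity
  rw [hasSum_iff_tendsto_nat_of_nonneg]
  · rw [← Filter.tendsto_add_atTop_iff_nat 1]
    simp only [sum_digit p hp lam h1 h2]
    have hz : Filter.Tendsto (fun n : ℕ => lam - (p : ℝ) ^ (-(n : ℤ))) Filter.atTop (nhds lam) := by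
      have : Filter.Tendsto (fun n : ℕ => ((p : ℝ)⁻¹) ^ n) Filter.atTop (nhds 0) :=
        tendsto_pow_atTop_nhds_zero_of_lt_one (by positivity)
          (inv_lt_one_of_one_lt₀ (by exact_mod_cast hp))
      simpa using this.const_sub lam
    refine tendsto_of_tendsto_of_tendsto_of_le_of_le hz tendsto_const_nhds (fun n => ?_)
      fun n => ?_
    · have h3 := Int.le_ceil (lam * (p : ℝ) ^ (n : ℤ) - 1)
      have h4 : (0 : ℝ) < (p : ℝ) ^ (-(n : ℤ)) := by positivity
      have h5 : (p : ℝ) ^ (n : ℤ) * (p : ℝ) ^ (-(n : ℤ)) = 1 := by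
        rw [← zpow_add₀ hp0.ne']; simp
      change lam - _ ≤ _
      nlinarith
    · have h3 := Int.ceil_lt_add_one (lam * (p : ℝ) ^ (n : ℤ) - 1)
      have h4 : (0 : ℝ) < (p : ℝ) ^ (-(n : ℤ)) := by positivity
      have h5 : (p : ℝ) ^ (n : ℤ) * (p : ℝ) ^ (-(n : ℤ)) = 1 := by
        rw [← zpow_add₀ hp0.ne']; simp
      change _ ≤ lam
      nlinarith
  · intro k
    have := (digit_mem p hp lam k).1
    have : (0 : ℝ) ≤ digit p lam k := by exact_mod_cast this
    positivity

theorem exists_digit_ne_zero (p : ℕ) (hp : 2 ≤ p) (lam : ℝ) (h1 : 1 < lam) (h2 : lam ≤ p)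
    (n : ℕ) : ∃ k, n < k ∧ digit p lam k ≠ 0 := by
  have hp0 : (0 : ℝ) < p := by positivity
  by_contra! h
  have h3 := (hasSum_sum_of_ne_finset_zero (s := Finset.range (n + 1))
    (f := fun k : ℕ => (digit p lam k : ℝ) * (p : ℝ) ^ (-(k : ℤ))) fun k hk => by
      rw [h k (by simpa using hk)]; simp).unique (hasSum_digit p hp lam h1 h2)
  rw [sum_digit p hp lam h1 h2] at h3
  have h4 := Int.ceil_lt_add_one (lam * (p : ℝ) ^ (n : ℤ) - 1)
  have h5 : (0 : ℝ) < (p : ℝ) ^ (-(n : ℤ)) := by positivity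
  have h6 : (p : ℝ) ^ (n : ℤ) * (p : ℝ) ^ (-(n : ℤ)) = 1 := by
    rw [← zpow_add₀ hp0.ne']; simp
  nlinarith

end ValuationSystem
end

set_option linter.unusedSectionVars false

noncomputable section

open scoped ComplexConjugate
open Filter Topology

namespace ValuationSystem

/-! ### Multiplication operators on `ℓ²` -/

section MulOp

variable {ι : Type}

/-! Everything reduces to a description of the orbit of `y`. At a finite place `w ≠ p` the component
of `y` is a unit, so `|k y_w| ≤ 1` says that the prime of `w` does not divide the denominator of
`k`; at `p` the component of `y` is zero and there is no condition; at infinity the condition is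
`|k| < λ = |y_∞|⁻¹`. Hence the fiber over `y` is the set of nonzero `k ∈ ℤ[1/p]` with `|k| < λ`
(`smul_mem_openBox_iff`). As `λ ≤ p`, the numerator of such a `k` is prime to `p`: otherwise `k`
would be an integer with `|k| ≥ p` (`not_dvd_num`). So `|k|_p = p^e`, where `p^e` is the
denominator, and `H_y` is diagonal with entries `e log p ≥ 0`. Every `e` occurs, because `p^{-e} ≤ 1
< λ`. Self-adjointness, the unitary group and the spectrum are facts about diagonal operators on
`ℓ²`.

For the partition function put `q = p^{-β}`, so that `β > 1` gives `pq < 1`. The elements with `e ≤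
j` are the fractions `n / p^j` with `0 < |n| < λp^j`, and there are `2N_j` of them, `N_j = ⌈λp^j -
1⌉`. Summation by parts, in the form `q^e = ∑_{j ≥ e} (1 - q) q^j`, gives `∑ q^e = 2(1 - q) ∑ N_j
q^j`, and the relation `c_j = N_j - p N_{j-1}` gives `∑ c_j q^j = (1 - pq) ∑ N_j q^j`
(`hasSum_pow_denExponent`).

The weights `e^{-βH_y}` being summable, the trace of `e^{-βH_y} A` exists in every orthonormal basis
and equals the weighted sum of the diagonal of `A` in the standard one (`hasTrace_mulCLM_mul`). The
KMS function is an explicit double series over matrix coefficients, and exchanging its two indices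
is the cyclicity of the trace (`exists_kms_function`). On `C_c(G)` the functional only sees the
values of `f` on the units: bump functions there give the lower bound for the norm (`norm_gibbs`),
and a majorant common to all orbits gives continuity in `y`, which extends to `C⋆(G)` by uniform
approximation (`continuous_gibbs`). -/

theorem hasSum_norm_sq (ξ : EllTwo ι) : HasSum (fun i => ‖ξ i‖ ^ 2) (‖ξ‖ ^ 2) := by
  simpa using lp.hasSum_norm (p := 2) (by simp) ξ

theorem memℓp_two_of_le (ξ : EllTwo ι) {u : ι → ℂ} (C : ℝ) (h : ∀ i, ‖u i‖ ≤ C * ‖ξ i‖) :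
    Memℓp u 2 := by
  refine memℓp_gen ?_
  have hs : Summable fun i => C ^ 2 * ‖ξ i‖ ^ 2 := (hasSum_norm_sq ξ).summable.mul_left _
  simp only [ENNReal.toReal_ofNat, Real.rpow_ofNat]
  refine hs.of_nonneg_of_le (fun _ => by positivity) fun i => ?_
  rw [← mul_pow]
  exact pow_le_pow_left₀ (norm_nonneg _) (h i) 2

theorem ellTwo_norm_le_of_le (η ξ : EllTwo ι) {C : ℝ} (hC : 0 ≤ C)
    (h : ∀ i, ‖η i‖ ≤ C * ‖ξ i‖) : ‖η‖ ≤ C * ‖ξ‖ := by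
  have h1 : ‖η‖ ≤ ‖(C : ℂ) • ξ‖ := by
    refine lp.norm_mono (by simp) fun i => ?_
    rw [lp.coeFn_smul, Pi.smul_apply, norm_smul, Complex.norm_real, Real.norm_of_nonneg hC]
    exact h i
  rwa [norm_smul, Complex.norm_real, Real.norm_of_nonneg hC] at h1

/-- Dominated convergence in `ℓ²`. -/
theorem tendsto_ellTwo_zero_of_dominated {α : Type*} {l : Filter α} {F : α → EllTwo ι}
    (g : EllTwo ι) (hF : ∀ i, Tendsto (fun a => F a i) l (𝓝 0))
    (hb : ∀ᶠ a in l, ∀ i, ‖F a i‖ ≤ ‖g i‖) : Tendsto F l (𝓝 0) := by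
  rw [tendsto_zero_iff_norm_tendsto_zero]
  have h1 : Tendsto (fun a => ∑' i, ‖F a i‖ ^ 2) l (𝓝 (∑' _ : ι, (0 : ℝ))) := by
    refine tendsto_tsum_of_dominated_convergence (hasSum_norm_sq g).summable (fun i => ?_) ?_
    · simpa using ((hF i).norm.pow 2)
    · filter_upwards [hb] with a ha i
      rw [Real.norm_of_nonneg (by positivity)]
      exact pow_le_pow_left₀ (norm_nonneg _) (ha i) 2
  simp only [(hasSum_norm_sq _).tsum_eq, tsum_zero] at h1
  simpa [Real.sqrt_sq] using h1.sqrt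

/-- The bounded operator of multiplication by a bounded function. -/
def mulCLM (h : ι → ℂ) {C : ℝ} (hC : ∀ i, ‖h i‖ ≤ C) : EllTwo ι →L[ℂ] EllTwo ι :=
  LinearMap.mkContinuous
    { toFun := fun ξ => ⟨fun i => h i * ξ i, memℓp_two_of_le ξ C fun i => by
        rw [norm_mul]; exact mul_le_mul_of_nonneg_right (hC i) (norm_nonneg _)⟩
      map_add' := fun ξ η => by
        ext i
        exact mul_add _ _ _
      map_smul' := fun c ξ => by
        ext i
        -- The bound `C` can be negative when `ι` is empty, whereas an operator bound has to be
        -- nonnegative.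
        exact mul_left_comm _ _ _ } |C| fun ξ => by
      refine ellTwo_norm_le_of_le _ _ (abs_nonneg C) fun i => ?_
      change ‖h i * ξ i‖ ≤ _
      rw [norm_mul]
      exact mul_le_mul_of_nonneg_right ((hC i).trans (le_abs_self C)) (norm_nonneg _)

@[simp] theorem mulCLM_apply (h : ι → ℂ) {C : ℝ} (hC : ∀ i, ‖h i‖ ≤ C) (ξ : EllTwo ι) (i : ι) :
    mulCLM h hC ξ i = h i * ξ i := rfl

theorem mem_domain_mulOp {h : ι → ℂ} {ξ : EllTwo ι} :
    ξ ∈ (mulOp h).domain ↔ Memℓp (fun i => h i * ξ i) 2 := Iff.rfl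

theorem mulOp_apply {h : ι → ℂ} (ξ : (mulOp h).domain) (i : ι) :
    mulOp h ξ i = h i * ξ.1 i := rfl

theorem mem_graph_mulOp {h : ι → ℂ} {ξ η : EllTwo ι} :
    (ξ, η) ∈ (mulOp h).graph ↔ ∀ i, η i = h i * ξ i := by
  rw [LinearPMap.mem_graph_iff]
  constructor
  · rintro ⟨x, rfl, rfl⟩ i
    rfl
  · intro H
    have : ξ ∈ (mulOp h).domain := by
      rw [mem_domain_mulOp, ← funext H]
      exact lp.memℓp η
    exact ⟨⟨ξ, this⟩, rfl, by ext i; exact (H i).symm⟩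

/-- An everywhere defined operator is determined by its graph, so the operator chosen in
`boundedMulOp` can only be `mulCLM h hC`, and for bounded `h` the default value `0` is not taken. -/
theorem boundedMulOp_eq (h : ι → ℂ) {C : ℝ} (hC : ∀ i, ‖h i‖ ≤ C) :
    boundedMulOp h = mulCLM h hC := by
  have key : ∀ T : EllTwo ι →L[ℂ] EllTwo ι,
      (T : EllTwo ι →ₗ[ℂ] EllTwo ι).toPMap ⊤ = mulOp h ↔ T = mulCLM h hC := by
    intro T
    constructor
    · intro H
      ext ξ i
      have : (ξ, T ξ) ∈ (mulOp h).graph := by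
        rw [← H, LinearPMap.mem_graph_iff]
        exact ⟨⟨ξ, trivial⟩, rfl, rfl⟩
      exact mem_graph_mulOp.1 this i
    · rintro rfl
      apply LinearPMap.eq_of_eq_graph
      ext ⟨ξ, η⟩
      rw [mem_graph_mulOp, LinearPMap.mem_graph_iff]
      constructor
      · rintro ⟨x, rfl, rfl⟩ i
        rfl
      · intro H
        exact ⟨⟨ξ, trivial⟩, rfl, by ext i; exact (H i).symm⟩
  unfold boundedMulOp
  have H : ∃ T : EllTwo ι →L[ℂ] EllTwo ι,
      (T : EllTwo ι →ₗ[ℂ] EllTwo ι).toPMap ⊤ = mulOp h := ⟨_, (key _).2 rfl⟩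
  rw [dif_pos H]
  exact (key _).1 H.choose_spec

open Classical in
/-- The standard orthonormal basis vectors of `ℓ²`. -/
def basisVec (k : ι) : EllTwo ι := lp.single 2 k 1

@[simp] theorem basisVec_self (k : ι) : basisVec k k = 1 := by
  classical
  exact Pi.single_eq_same (M := fun _ : ι => ℂ) k 1

theorem basisVec_ne {k l : ι} (h : l ≠ k) : basisVec k l = 0 :=
  by classical exact Pi.single_eq_of_ne (M := fun _ : ι => ℂ) h 1

@[simp] theorem norm_basisVec (k : ι) : ‖basisVec k‖ = 1 := by
  classical
  rw [basisVec, lp.norm_single (by simp), norm_one]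

@[simp] theorem inner_basisVec_left (k : ι) (ξ : EllTwo ι) : inner ℂ (basisVec k) ξ = ξ k := by
  classical
  rw [basisVec, lp.inner_single_left]
  simp

theorem mul_basisVec (h : ι → ℂ) (k i : ι) : h i * basisVec k i = h k * basisVec k i := by
  by_cases hi : i = k
  · rw [hi]
  · simp [basisVec_ne hi]

theorem basisVec_mem_graph (h : ι → ℂ) (k : ι) :
    (basisVec k, h k • basisVec k) ∈ (mulOp h).graph :=
  mem_graph_mulOp.2 fun i => (mul_basisVec h k i).symm

theorem basisVec_mem_domain (h : ι → ℂ) (k : ι) : basisVec k ∈ (mulOp h).domain := by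
  obtain ⟨x, hx, -⟩ := (LinearPMap.mem_graph_iff _).1 (basisVec_mem_graph h k)
  rw [← show (x : EllTwo ι) = basisVec k from hx]
  exact x.2

/-- Finite truncations of a vector lie in the domain, whatever the growth of `h`, and converge to
the vector. -/
theorem dense_domain_mulOp (h : ι → ℂ) : Dense ((mulOp h).domain : Set (EllTwo ι)) := by
  classical
  intro ξ
  refine mem_closure_of_tendsto (lp.hasSum_single (by simp) ξ) (Eventually.of_forall fun s => ?_)
  refine Submodule.sum_mem _ fun i _ => ?_
  have : lp.single 2 i (ξ i) = ξ i • (basisVec i : EllTwo ι) := by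
    rw [basisVec, ← lp.single_smul, smul_eq_mul, mul_one]
  rw [this]
  exact Submodule.smul_mem _ _ (basisVec_mem_domain h i)

/-- Testing the adjoint relation on the basis vectors alone already forces `η i = h i * ξ i`. Since
the domain of `mulOp` is maximal, this says that the pair is in its graph, so the adjoint is no
larger than the operator. The other inclusion is the symmetry of a real multiplier. -/
theorem isSelfAdjoint_mulOp (h : ι → ℝ) : IsSelfAdjoint (mulOp fun i => (h i : ℂ)) := by
  rw [LinearPMap.isSelfAdjoint_def]
  apply LinearPMap.eq_of_eq_graph
  rw [LinearPMap.adjoint_graph_eq_graph_adjoint (dense_domain_mulOp _)]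
  ext ⟨ξ, η⟩
  rw [Submodule.mem_adjoint_iff, mem_graph_mulOp]
  constructor
  · intro H i
    have := H _ _ (basisVec_mem_graph (fun i => (h i : ℂ)) i)
    simp only [inner_smul_left, inner_basisVec_left, Complex.conj_ofReal] at this
    linear_combination -this
  · intro H a b hab
    rw [mem_graph_mulOp] at hab
    rw [sub_eq_zero]
    refine (lp.hasSum_inner b ξ).unique ?_
    have e : (fun i => inner ℂ (b i) (ξ i)) = fun i => inner ℂ (a i) (η i) := by
      funext i
      simp only [hab i, H i, RCLike.inner_apply, map_mul, Complex.conj_ofReal]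
      ring
    rw [e]
    exact lp.hasSum_inner a η

theorem mulOp_nonneg {h : ι → ℝ} (h0 : ∀ i, 0 ≤ h i) (ξ : (mulOp fun i => (h i : ℂ)).domain) :
    0 ≤ (inner ℂ (ξ : EllTwo ι) (mulOp (fun i => (h i : ℂ)) ξ)).re := by
  have h1 := Complex.hasSum_re (lp.hasSum_inner (ξ : EllTwo ι) (mulOp (fun i => (h i : ℂ)) ξ))
  refine h1.nonneg fun i => ?_
  have : inner ℂ (ξ.1 i) (mulOp (fun i => (h i : ℂ)) ξ i) =
      ((h i * ‖ξ.1 i‖ ^ 2 : ℝ) : ℂ) := by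
    rw [mulOp_apply, RCLike.inner_apply, mul_assoc, Complex.mul_conj, Complex.normSq_eq_norm_sq]
    push_cast
    ring
  rw [this, Complex.ofReal_re]
  have := h0 i
  positivity

/-- Values of `h` are eigenvalues. Off the range, closedness gives a positive distance `ε`, and `(h
- z)⁻¹` is then bounded by `ε⁻¹`; in general the spectrum would be the closure of the range. -/
theorem unboundedSpectrum_mulOp {h : ι → ℂ} (hc : IsClosed (Set.range h)) :
    unboundedSpectrum (mulOp h) = Set.range h := by
  ext z
  constructor
  · intro hz
    by_contra hn
    apply hz
    obtain ⟨ε, hε, hb⟩ := Metric.isOpen_iff.1 hc.isOpen_compl z hn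
    have hd : ∀ i, ε ≤ ‖h i - z‖ := by
      intro i
      by_contra! hlt
      exact hb (show h i ∈ Metric.ball z ε by rwa [Metric.mem_ball, dist_eq_norm]) ⟨i, rfl⟩
    have hne : ∀ i, h i - z ≠ 0 := fun i h0 => by
      have := hd i
      rw [h0, norm_zero] at this
      linarith
    have hC : ∀ i, ‖(h i - z)⁻¹‖ ≤ ε⁻¹ := fun i => by
      rw [norm_inv]
      exact inv_anti₀ hε (hd i)
    refine ⟨mulCLM _ hC, fun ξ => ?_, fun ξ => ?_⟩
    · have hg : (mulCLM _ hC ξ, ξ + z • mulCLM _ hC ξ) ∈ (mulOp h).graph := by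
        rw [mem_graph_mulOp]
        intro i
        have := hne i
        simp only [lp.coeFn_add, lp.coeFn_smul, Pi.add_apply, Pi.smul_apply, mulCLM_apply,
          smul_eq_mul]
        field_simp
        ring
      obtain ⟨x, hx, hx'⟩ := (LinearPMap.mem_graph_iff _).1 hg
      simp only at hx hx'
      refine ⟨hx ▸ x.2, ?_⟩
      have : (⟨mulCLM _ hC ξ, hx ▸ x.2⟩ : (mulOp h).domain) = x := Subtype.ext hx.symm
      rw [this, hx']
      simp
    · ext i
      have := hne i
      simp only [lp.coeFn_sub, lp.coeFn_smul, Pi.sub_apply, Pi.smul_apply, mulCLM_apply,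
        smul_eq_mul, mulOp_apply]
      field_simp
  · rintro ⟨k, rfl⟩ ⟨R, -, hR⟩
    have h1 := hR ⟨basisVec k, basisVec_mem_domain h k⟩
    have h2 : mulOp h ⟨basisVec k, basisVec_mem_domain h k⟩ - h k • basisVec k = 0 := by
      ext i
      simp only [lp.coeFn_sub, lp.coeFn_smul, Pi.sub_apply, Pi.smul_apply, smul_eq_mul,
        mulOp_apply, mul_basisVec h k i, sub_self]
      rfl
    rw [h2, map_zero] at h1
    change 0 = basisVec k at h1
    have h3 := norm_basisVec k
    rw [← h1, norm_zero] at h3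
    exact zero_ne_one h3

/-! ### The unitary group generated by a real multiplication operator -/

theorem norm_exp_mul_I_le (h : ι → ℝ) (t : ℝ) (i : ι) :
    ‖Complex.exp (Complex.I * (t * h i : ℝ))‖ ≤ 1 := by
  rw [mul_comm, Complex.norm_exp_ofReal_mul_I]

/-- The unitary operator of multiplication by `e^{ith}`. -/
def expMul (h : ι → ℝ) (t : ℝ) : EllTwo ι →L[ℂ] EllTwo ι := mulCLM _ (norm_exp_mul_I_le h t)

@[simp] theorem expMul_apply (h : ι → ℝ) (t : ℝ) (ξ : EllTwo ι) (i : ι) :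
    expMul h t ξ i = Complex.exp (Complex.I * (t * h i : ℝ)) * ξ i := rfl

theorem expMul_zero (h : ι → ℝ) : expMul h 0 = 1 := by
  ext ξ i
  simp

theorem expMul_add (h : ι → ℝ) (s t : ℝ) : expMul h (s + t) = expMul h s * expMul h t := by
  ext ξ i
  simp only [expMul_apply, mul_apply_eq_comp, ← mul_assoc, ← Complex.exp_add]
  congr 2
  push_cast
  ring

theorem star_expMul (h : ι → ℝ) (t : ℝ) : star (expMul h t) = expMul h (-t) := by
  symm
  rw [ContinuousLinearMap.star_eq_adjoint, ContinuousLinearMap.eq_adjoint_iff]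
  intro η ξ
  refine (lp.hasSum_inner _ _).unique ?_
  have e : (fun i => inner ℂ (expMul h (-t) η i) (ξ i)) =
      fun i => inner ℂ (η i) (expMul h t ξ i) := by
    funext i
    simp only [expMul_apply, RCLike.inner_apply, map_mul, ← Complex.exp_conj, Complex.conj_I,
      Complex.conj_ofReal]
    push_cast
    ring_nf
  rw [e]
  exact lp.hasSum_inner _ _

/-- Strong continuity and differentiability on the domain are coordinatewise limits upgraded by
dominated convergence. Conversely, a derivative in norm is a derivative in each coordinate, which
forces `η i = h i * ξ i`, and the domain of `mulOp` is maximal. -/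
theorem isExpOf_expMul (h : ι → ℝ) : IsExpOf (expMul h) (mulOp fun i => (h i : ℂ)) where
  mem_unitary t := by
    rw [Unitary.mem_iff, star_expMul, ← expMul_add, ← expMul_add]
    simp [expMul_zero]
  zero := expMul_zero h
  add := expMul_add h
  continuous ξ := by
    rw [continuous_iff_continuousAt]
    intro s
    have h0 : Tendsto (fun t => expMul h t ξ - expMul h s ξ) (𝓝 s) (𝓝 0) := by
      refine tendsto_ellTwo_zero_of_dominated ((2 : ℂ) • ξ) (fun i => ?_)
        (Eventually.of_forall fun t i => ?_)
      · have : Continuous fun t : ℝ => Complex.exp (Complex.I * (t * h i : ℝ)) * ξ i -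
            Complex.exp (Complex.I * (s * h i : ℝ)) * ξ i := by fun_prop
        simpa using this.tendsto s
      · simp only [lp.coeFn_sub, lp.coeFn_smul, Pi.sub_apply, Pi.smul_apply, expMul_apply,
          smul_eq_mul, ← sub_mul, norm_mul]
        refine mul_le_mul_of_nonneg_right ((norm_sub_le _ _).trans ?_) (norm_nonneg _)
        have := norm_exp_mul_I_le h t i
        have := norm_exp_mul_I_le h s i
        have h3 : ‖(2 : ℂ)‖ = 2 := by norm_num
        rw [h3]
        linarith
    have := h0.add_const (expMul h s ξ)
    simpa [ContinuousAt] using this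
  generator ξ η := by
    rw [mem_graph_mulOp]
    have hd : ∀ i, HasDerivAt (fun t : ℝ => Complex.exp (Complex.I * (t * h i : ℝ)) * ξ i)
        (Complex.I * (h i * ξ i)) 0 := by
      intro i
      have h1 : HasDerivAt (fun t : ℝ => Complex.I * ((t * h i : ℝ) : ℂ)) (Complex.I * h i) 0 := by
        have := (((hasDerivAt_id (0 : ℝ)).mul_const (h i)).ofReal_comp).const_mul Complex.I
        simpa using this
      have := (h1.cexp).mul_const (ξ i)
      simpa [mul_assoc] using this
    constructor
    · intro H
      refine hasDerivAt_iff_tendsto_slope_zero.2 ?_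
      have h0 : Tendsto (fun t : ℝ => t⁻¹ • (expMul h (0 + t) ξ - expMul h 0 ξ) - Complex.I • η)
          (𝓝[≠] 0) (𝓝 0) := by
        -- Since `|e^{ix} - 1| ≤ |x|`, the difference quotient is bounded by `‖η i‖` in each
        -- coordinate; the subtracted limit `i η` contributes another `‖η i‖`.
        refine tendsto_ellTwo_zero_of_dominated ((2 : ℂ) • η) (fun i => ?_)
          (Eventually.of_forall fun t i => ?_)
        · have := hasDerivAt_iff_tendsto_slope_zero.1 (hd i)
          have := this.sub_const (Complex.I * (h i * ξ i))
          rw [sub_self] at this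
          refine this.congr fun t => ?_
          rw [← H i]
          rfl
        · simp only [lp.coeFn_sub, lp.coeFn_smul, Pi.sub_apply, Pi.smul_apply, expMul_apply,
            smul_eq_mul, norm_mul, zero_add, zero_mul, Complex.ofReal_zero, mul_zero,
            Complex.exp_zero, one_mul]
          refine (norm_sub_le _ _).trans ?_
          have h1 : ‖Complex.exp (Complex.I * (t * h i : ℝ)) * ξ i - ξ i‖ ≤ |t| * ‖η i‖ := by
            rw [← sub_one_mul, norm_mul, H i, norm_mul, Complex.norm_real, ← mul_assoc]
            refine mul_le_mul_of_nonneg_right ?_ (norm_nonneg _)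
            refine Real.norm_exp_I_mul_ofReal_sub_one_le.trans ?_
            rw [norm_mul, Real.norm_eq_abs]
          have h2 : ‖t⁻¹ • (Complex.exp (Complex.I * (t * h i : ℝ)) * ξ i - ξ i)‖ ≤ ‖η i‖ := by
            rw [norm_smul, norm_inv, Real.norm_eq_abs]
            -- The bound is proved for all `t`; at `t = 0` it holds because `0⁻¹ = 0`.
            rcases eq_or_ne t 0 with rfl | ht
            · simp
            · rw [inv_mul_le_iff₀ (abs_pos.2 ht)]
              exact h1
          have h3 : ‖(2 : ℂ)‖ = 2 := by norm_num
          rw [norm_mul, Complex.norm_I, one_mul, h3]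
          linarith
      have := h0.add_const (Complex.I • η)
      simpa using this
    · intro H i
      have h1 : HasDerivAt (fun t : ℝ => inner ℂ (basisVec i) (expMul h t ξ))
          (inner ℂ (basisVec i) (Complex.I • η)) 0 :=
        ((innerSL ℂ (basisVec i : EllTwo ι)).restrictScalars ℝ).hasFDerivAt.comp_hasDerivAt 0 H
      simp only [inner_basisVec_left, expMul_apply] at h1
      have h2 := h1.unique (hd i)
      simpa using h2

end MulOp

/-! ### Traces of products with diagonal operators -/

section Trace

variable {ι : Type}

open ContinuousLinearMap in
theorem adjoint_basisVec_apply (A : EllTwo ι →L[ℂ] EllTwo ι) (k l : ι) :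
    adjoint A (basisVec k) l = conj (A (basisVec l) k) := by
  rw [← inner_basisVec_left, adjoint_inner_right, ← inner_conj_symm, inner_basisVec_left]

open ContinuousLinearMap in
theorem inner_adjoint_basisVec (A : EllTwo ι →L[ℂ] EllTwo ι) (k : ι) (ξ : EllTwo ι) :
    inner ℂ (adjoint A (basisVec k)) ξ = A ξ k := by
  rw [adjoint_inner_left, inner_basisVec_left]

theorem norm_apply_basisVec_le (A : EllTwo ι →L[ℂ] EllTwo ι) (k : ι) :
    ‖A (basisVec k)‖ ≤ ‖A‖ := by
  simpa using A.le_opNorm (basisVec k)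

theorem norm_adjoint_basisVec_le (A : EllTwo ι →L[ℂ] EllTwo ι) (k : ι) :
    ‖ContinuousLinearMap.adjoint A (basisVec k)‖ ≤ ‖A‖ := by
  simpa using norm_apply_basisVec_le (ContinuousLinearMap.adjoint A) k

theorem norm_coeff_le (A : EllTwo ι →L[ℂ] EllTwo ι) (k l : ι) : ‖A (basisVec l) k‖ ≤ ‖A‖ :=
  (lp.norm_apply_le_norm (by simp) _ k).trans (norm_apply_basisVec_le A l)

/-- This is matrix multiplication. The series converges because the rows of `A` are, up to
conjugation, the vectors `A* e_k`, so that it is an inner product in `ℓ²`. -/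
theorem hasSum_mul_coeff (A B : EllTwo ι →L[ℂ] EllTwo ι) (k l : ι) :
    HasSum (fun m => A (basisVec m) k * B (basisVec l) m) ((A * B) (basisVec l) k) := by
  have h := lp.hasSum_inner (𝕜 := ℂ) (ContinuousLinearMap.adjoint A (basisVec k)) (B (basisVec l))
  rw [inner_adjoint_basisVec] at h
  refine HasSum.congr_fun h fun m => ?_
  rw [RCLike.inner_apply, adjoint_basisVec_apply, Complex.conj_conj, mul_comm]

theorem hasSum_coeff_sq (A : EllTwo ι →L[ℂ] EllTwo ι) (l : ι) :
    HasSum (fun k => ‖A (basisVec l) k‖ ^ 2) (‖A (basisVec l)‖ ^ 2) :=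
  hasSum_norm_sq _

theorem hasSum_coeff_row_sq (A : EllTwo ι →L[ℂ] EllTwo ι) (k : ι) :
    HasSum (fun l => ‖A (basisVec l) k‖ ^ 2)
      (‖ContinuousLinearMap.adjoint A (basisVec k)‖ ^ 2) := by
  simpa only [adjoint_basisVec_apply, RCLike.norm_conj] using
    hasSum_norm_sq (ContinuousLinearMap.adjoint A (basisVec k))

theorem _root_.HilbertBasis.hasSum_norm_inner_sq {κ E : Type*} [NormedAddCommGroup E]
    [InnerProductSpace ℂ E] (b : HilbertBasis κ ℂ E) (x : E) :
    HasSum (fun i => ‖inner ℂ (b i) x‖ ^ 2) (‖x‖ ^ 2) := by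
  have h := lp.hasSum_norm (p := 2) (by simp) (b.repr x)
  simpa [b.repr_apply_apply] using h

/-- A family on a product is summable if its rows are dominated, up to summable weights, by
products of square-summable families of bounded norm. -/
theorem summable_weighted_mul {κ : Type*} {d : ι → ℝ} (hd : Summable d) (hd0 : ∀ k, 0 ≤ d k)
    {f g : ι → κ → ℝ} {C D : ℝ} {F G : ι → ℝ}
    (hf : ∀ k, HasSum (fun i => f k i ^ 2) (F k)) (hg : ∀ k, HasSum (fun i => g k i ^ 2) (G k))
    (hF : ∀ k, F k ≤ C) (hG : ∀ k, G k ≤ D) (hf0 : ∀ k i, 0 ≤ f k i) (hg0 : ∀ k i, 0 ≤ g k i) :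
    Summable fun x : ι × κ => d x.1 * (f x.1 x.2 * g x.1 x.2) := by
  have hle : ∀ x : ι × κ, d x.1 * (f x.1 x.2 * g x.1 x.2) ≤
      d x.1 * (f x.1 x.2 ^ 2 + g x.1 x.2 ^ 2) := fun x => by
    refine mul_le_mul_of_nonneg_left ?_ (hd0 _)
    nlinarith [sq_nonneg (f x.1 x.2 - g x.1 x.2), sq_nonneg (f x.1 x.2), sq_nonneg (g x.1 x.2)]
  refine Summable.of_nonneg_of_le (fun x => mul_nonneg (hd0 _) (mul_nonneg (hf0 _ _) (hg0 _ _)))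
    hle ?_
  rw [summable_prod_of_nonneg fun x => mul_nonneg (hd0 _) (by positivity)]
  have hrow : ∀ k, HasSum (fun i => d k * (f k i ^ 2 + g k i ^ 2)) (d k * (F k + G k)) :=
    fun k => ((hf k).add (hg k)).mul_left _
  refine ⟨fun k => (hrow k).summable, ?_⟩
  simp only [(hrow _).tsum_eq]
  refine (hd.mul_right (C + D)).of_nonneg_of_le (fun k => mul_nonneg (hd0 k) ?_) fun k =>
    mul_le_mul_of_nonneg_left (add_le_add (hF k) (hG k)) (hd0 k)
  exact add_nonneg ((hf k).nonneg fun _ => sq_nonneg _) ((hg k).nonneg fun _ => sq_nonneg _)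

theorem summable_mul_diag {d : ι → ℝ} (hd : Summable d) (hd0 : ∀ k, 0 ≤ d k)
    (A : EllTwo ι →L[ℂ] EllTwo ι) : Summable fun k => (d k : ℂ) * A (basisVec k) k := by
  refine Summable.of_norm_bounded (hd.mul_right ‖A‖) fun k => ?_
  rw [norm_mul, Complex.norm_real, Real.norm_of_nonneg (hd0 k)]
  exact mul_le_mul_of_nonneg_left (norm_coeff_le A k k) (hd0 k)

/-- In a basis `b`, each diagonal entry expands over the standard basis into terms `d_k ⟨A* e_k,
b_i⟩ ⟨b_i, e_k⟩`. By Parseval and the summability of `d` the double family is absolutely summable.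
Summing over `k` first gives the diagonal in `b`; summing over `i` first gives `d_k A_kk`,
independently of `b`. -/
theorem hasTrace_mulCLM_mul {d : ι → ℝ} (hd : Summable d) (hd0 : ∀ k, 0 ≤ d k) {C : ℝ}
    (hC : ∀ k, ‖(d k : ℂ)‖ ≤ C) (A : EllTwo ι →L[ℂ] EllTwo ι) :
    HasTrace (mulCLM (fun k => (d k : ℂ)) hC * A) (∑' k, (d k : ℂ) * A (basisVec k) k) := by
  intro κ b
  let G : ι × κ → ℂ := fun x => (d x.1 : ℂ) *
    (inner ℂ (ContinuousLinearMap.adjoint A (basisVec x.1)) (b x.2) *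
      inner ℂ (b x.2) (basisVec x.1))
  have hG : Summable G := by
    have h := summable_weighted_mul hd hd0
      (f := fun k i => ‖inner ℂ (b i) (ContinuousLinearMap.adjoint A (basisVec k))‖)
      (g := fun k i => ‖inner ℂ (b i) (basisVec k)‖) (C := ‖A‖ ^ 2) (D := 1)
      (fun k => b.hasSum_norm_inner_sq _) (fun k => b.hasSum_norm_inner_sq _)
      (fun k => pow_le_pow_left₀ (norm_nonneg _) (norm_adjoint_basisVec_le A k) 2)
      (fun k => by simp) (fun _ _ => norm_nonneg _) (fun _ _ => norm_nonneg _)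
    refine Summable.of_norm_bounded h fun x => le_of_eq ?_
    rw [norm_mul, norm_mul, Complex.norm_real, Real.norm_of_nonneg (hd0 _),
      norm_inner_symm (ContinuousLinearMap.adjoint A (basisVec x.1))]
  have hrow : ∀ k, HasSum (fun i => G (k, i)) ((d k : ℂ) * A (basisVec k) k) := fun k => by
    have := (b.hasSum_inner_mul_inner (ContinuousLinearMap.adjoint A (basisVec k))
      (basisVec k)).mul_left (d k : ℂ)
    rwa [inner_adjoint_basisVec] at this
  have hcol : ∀ i, HasSum (fun k => G (k, i))
      (inner ℂ (b i) ((mulCLM (fun k => (d k : ℂ)) hC * A) (b i))) := fun i => by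
    have h := lp.hasSum_inner (𝕜 := ℂ) (b i) ((mulCLM (fun k => (d k : ℂ)) hC * A) (b i))
    refine HasSum.congr_fun h fun k => ?_
    simp only [G, inner_adjoint_basisVec, mul_apply_eq_comp, mulCLM_apply, RCLike.inner_apply]
    rw [← inner_conj_symm (b i), inner_basisVec_left]
    ring
  have hswap : HasSum (fun x : κ × ι => G (x.2, x.1)) (∑' x, G x) :=
    (Equiv.prodComm κ ι).hasSum_iff.mpr hG.hasSum
  have h1 := hswap.prod_fiberwise hcol
  rwa [(hG.hasSum.prod_fiberwise hrow).tsum_eq]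

end Trace

/-! ### The KMS condition for Gibbs functionals -/

section Gibbs

variable {ι : Type}

/-- The exponent is a weighted mean of `-βx` and `-βy`, hence at most the larger of the two. The sum
of the exponentials is used in place of their maximum because it splits into two summable families.
-/
theorem exp_neg_interpolate_le {β s : ℝ} (h0 : 0 ≤ s) (h1 : s ≤ β) (x y : ℝ) :
    Real.exp (-(β - s) * x - s * y) ≤ Real.exp (-β * x) + Real.exp (-β * y) := by
  rcases le_total x y with h | h
  · refine le_add_of_le_of_nonneg (Real.exp_le_exp.2 ?_) (Real.exp_pos _).le
    nlinarith
  · refine le_add_of_nonneg_of_le (Real.exp_pos _).le (Real.exp_le_exp.2 ?_)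
    nlinarith

/-- Take `F(z) = ∑_{k,l} A_kl B_lk exp(-(β + iz) h_k + iz h_l)`. On the strip its terms have a
summable majorant independent of `z`, so `F` is bounded, continuous up to the boundary and
holomorphic inside. On the real line the weight `e^{-βh}` sits on the index `k`; at `t + iβ` it has
moved to `l`, and exchanging the indices reverses the order of the two operators. -/
theorem exists_kms_function {h : ι → ℝ} {β : ℝ} (hβ : 0 < β)
    (hd : Summable fun k => Real.exp (-β * h k)) (A B : EllTwo ι →L[ℂ] EllTwo ι) :
    ∃ F : ℂ → ℂ,
      ContinuousOn F {z | 0 ≤ z.im ∧ z.im ≤ β} ∧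
      DifferentiableOn ℂ F {z | 0 < z.im ∧ z.im < β} ∧
      (∃ C : ℝ, ∀ z : ℂ, 0 ≤ z.im → z.im ≤ β → ‖F z‖ ≤ C) ∧
      (∀ t : ℝ, F t = ∑' k, (Real.exp (-β * h k) : ℂ) *
        (A * (expMul h t * B * expMul h (-t))) (basisVec k) k) ∧
      ∀ t : ℝ, F (t + Complex.I * β) = ∑' k, (Real.exp (-β * h k) : ℂ) *
        (expMul h t * B * expMul h (-t) * A) (basisVec k) k := by
  set d : ι → ℝ := fun k => Real.exp (-β * h k) with hd_def
  have hd0 : ∀ k, 0 ≤ d k := fun k => (Real.exp_pos _).le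
  let G : ι × ι → ℂ → ℂ := fun x z => A (basisVec x.2) x.1 * B (basisVec x.1) x.2 *
    Complex.exp (-(β + Complex.I * z) * h x.1 + Complex.I * z * h x.2)
  -- The majorant has one summand for each boundary line of the strip: the weight is on the first
  -- index at `Im z = 0` and on the second at `Im z = β`.
  let u : ι × ι → ℝ := fun x => d x.1 * (‖A (basisVec x.2) x.1‖ * ‖B (basisVec x.1) x.2‖) +
    d x.2 * (‖A (basisVec x.2) x.1‖ * ‖B (basisVec x.1) x.2‖)
  have hu1 : Summable fun x : ι × ι =>
      d x.1 * (‖A (basisVec x.2) x.1‖ * ‖B (basisVec x.1) x.2‖) :=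
    summable_weighted_mul hd hd0 (f := fun k l => ‖A (basisVec l) k‖)
      (g := fun k l => ‖B (basisVec k) l‖) (fun k => hasSum_coeff_row_sq A k)
      (fun k => hasSum_coeff_sq B k)
      (fun k => pow_le_pow_left₀ (norm_nonneg _) (norm_adjoint_basisVec_le A k) 2)
      (fun k => pow_le_pow_left₀ (norm_nonneg _) (norm_apply_basisVec_le B k) 2)
      (fun _ _ => norm_nonneg _) (fun _ _ => norm_nonneg _)
  have hu2 : Summable fun x : ι × ι =>
      d x.2 * (‖A (basisVec x.2) x.1‖ * ‖B (basisVec x.1) x.2‖) :=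
    (Equiv.prodComm ι ι).summable_iff.mpr
      (summable_weighted_mul hd hd0 (f := fun k l => ‖A (basisVec k) l‖)
        (g := fun k l => ‖B (basisVec l) k‖) (fun k => hasSum_coeff_sq A k)
        (fun k => hasSum_coeff_row_sq B k)
        (fun k => pow_le_pow_left₀ (norm_nonneg _) (norm_apply_basisVec_le A k) 2)
        (fun k => pow_le_pow_left₀ (norm_nonneg _) (norm_adjoint_basisVec_le B k) 2)
        (fun _ _ => norm_nonneg _) (fun _ _ => norm_nonneg _))
  have hu : Summable u := hu1.add hu2
  have hle : ∀ x z, 0 ≤ z.im → z.im ≤ β → ‖G x z‖ ≤ u x := by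
    intro x z h0 h1
    simp only [G, u, norm_mul, Complex.norm_exp]
    have e : (-(β + Complex.I * z) * h x.1 + Complex.I * z * h x.2).re =
        -(β - z.im) * h x.1 - z.im * h x.2 := by
      simp [Complex.add_re, Complex.mul_re]
      ring
    rw [e, ← add_mul, mul_comm]
    exact mul_le_mul_of_nonneg_right (exp_neg_interpolate_le h0 h1 _ _) (by positivity)
  have hcoef : ∀ t k l, (expMul h t * B * expMul h (-t)) (basisVec l) k =
      Complex.exp (Complex.I * t * h k - Complex.I * t * h l) * B (basisVec l) k := by
    intro t k l
    have e : expMul h (-t) (basisVec l) =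
        Complex.exp (-(Complex.I * t * h l)) • basisVec l := by
      ext i
      rw [expMul_apply, mul_basisVec (fun i => Complex.exp (Complex.I * ((-t * h i : ℝ) : ℂ)))]
      simp only [lp.coeFn_smul, Pi.smul_apply, smul_eq_mul]
      congr 2
      push_cast
      ring
    rw [mul_apply_eq_comp, mul_apply_eq_comp, e, map_smul, expMul_apply, lp.coeFn_smul,
      Pi.smul_apply, smul_eq_mul, ← mul_assoc, ← Complex.exp_add]
    congr 2
    push_cast
    ring
  have hs : ∀ z : ℂ, 0 ≤ z.im → z.im ≤ β → Summable fun x => G x z :=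
    fun z h0 h1 => Summable.of_norm_bounded hu fun x => hle x z h0 h1
  have hdiff : ∀ x, Differentiable ℂ (G x) := fun x => by
    simp only [G]
    fun_prop
  refine ⟨fun z => ∑' x, G x z, ?_, ?_, ⟨∑' x, u x, ?_⟩, ?_, ?_⟩
  · exact continuousOn_tsum (fun x => (hdiff x).continuous.continuousOn) hu
      fun x z hz => hle x z hz.1 hz.2
  · refine Complex.differentiableOn_tsum_of_summable_norm hu
      (fun x => (hdiff x).differentiableOn) ?_ fun x z hz => hle x z hz.1.le hz.2.le
    exact (isOpen_lt continuous_const Complex.continuous_im).inter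
      (isOpen_lt Complex.continuous_im continuous_const)
  · intro z h0 h1
    exact tsum_of_norm_bounded hu.hasSum fun x => hle x z h0 h1
  · intro t
    have hsum := hs t (by simp) (by simpa using hβ.le)
    refine ((hsum.hasSum.prod_fiberwise fun k => ?_).tsum_eq).symm
    refine HasSum.congr_fun ((hasSum_mul_coeff A
      (expMul h t * B * expMul h (-t)) k k).mul_left (Real.exp (-β * h k) : ℂ)) fun l => ?_
    rw [hcoef]
    simp only [G]
    rw [Complex.ofReal_exp, show (-(β + Complex.I * t) * h k + Complex.I * t * h l : ℂ) =
      ((-β * h k : ℝ) : ℂ) + (Complex.I * t * h l - Complex.I * t * h k) by push_cast; ring,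
      Complex.exp_add]
    ring
  · intro t
    have him : ((t : ℂ) + Complex.I * β).im = β := by simp
    have hsum := hs (t + Complex.I * β) (by rw [him]; exact hβ.le) him.le
    -- The weight is now on the second index, so that index becomes the outer one.
    have hswap : HasSum (fun x : ι × ι => G (x.2, x.1) (t + Complex.I * β)) _ :=
      (Equiv.prodComm ι ι).hasSum_iff.mpr hsum.hasSum
    refine ((hswap.prod_fiberwise fun k => ?_).tsum_eq).symm
    refine HasSum.congr_fun ((hasSum_mul_coeff
      (expMul h t * B * expMul h (-t)) A k k).mul_left (Real.exp (-β * h k) : ℂ)) fun l => ?_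
    rw [hcoef]
    simp only [G]
    rw [Complex.ofReal_exp, show (-(β + Complex.I * (t + Complex.I * β)) * h l +
        Complex.I * (t + Complex.I * β) * h k : ℂ) =
      ((-β * h k : ℝ) : ℂ) + (Complex.I * t * h k - Complex.I * t * h l) by
        push_cast
        linear_combination (β * h k - β * h l : ℂ) * Complex.I_mul_I,
      Complex.exp_add]
    ring

end Gibbs

/-! ### Counting bounded elements of `ℤ[1/p]` -/

section Counting

/-- The nonzero elements of `ℤ[1/p]` of absolute value less than `lam`. -/
def boundedFractions (p : ℕ) (lam : ℝ) : Set ℚˣ :=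
  {k | (∀ q : ℕ, q.Prime → q ≠ p → ¬ q ∣ (k : ℚ).den) ∧ |((k : ℚ) : ℝ)| < lam}

/-- The exponent of `p` in the denominator. -/
def denExponent (p : ℕ) (k : ℚˣ) : ℕ := padicValNat p (k : ℚ).den

variable {p : ℕ} [hp : Fact p.Prime] {lam : ℝ}

theorem boundedFractions_mono {lam' : ℝ} (h : lam ≤ lam') :
    boundedFractions p lam ⊆ boundedFractions p lam' :=
  fun _ hk => ⟨hk.1, hk.2.trans_le h⟩

theorem den_eq_pow_denExponent {k : ℚˣ} (hk : k ∈ boundedFractions p lam) :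
    (k : ℚ).den = p ^ denExponent p k := by
  have h := Nat.eq_prime_pow_of_unique_prime_dvd (p := p) (k : ℚ).den_nz fun {q} hq hqd => by
    by_contra hne
    exact hk.1 q hq hne hqd
  unfold denExponent
  rw [h, padicValNat.prime_pow]

/-- If `p` divides the numerator, it does not divide the denominator, which is a power of `p` and
hence `1`. So `k` is a nonzero integer divisible by `p`, contradicting `|k| < p`. This is what
excludes negative values of `log |k|_p`. -/
theorem not_dvd_num {k : ℚˣ} (hk : k ∈ boundedFractions p p) : ¬ (p : ℤ) ∣ (k : ℚ).num := by
  intro hd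
  have hnd : ¬ p ∣ (k : ℚ).den := fun h => by
    have := Nat.dvd_gcd (Int.natCast_dvd.1 hd) h
    rw [(k : ℚ).reduced] at this
    exact hp.out.one_lt.ne' (Nat.dvd_one.1 this)
  have hden : (k : ℚ).den = 1 := by
    rw [den_eq_pow_denExponent hk, denExponent, padicValNat.eq_zero_of_not_dvd hnd, pow_zero]
  have h1 : ((k : ℚ).num : ℚ) = k := Rat.coe_int_num_of_den_eq_one hden
  have h2 : (p : ℤ) ≤ |(k : ℚ).num| :=
    Int.le_of_dvd (abs_pos.2 (Rat.num_ne_zero.2 k.ne_zero)) ((dvd_abs _ _).2 hd)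
  have h3 := hk.2
  rw [← h1] at h3
  have h4 : ((|(k : ℚ).num| : ℤ) : ℝ) < p := by
    rw [Int.cast_abs]
    exact_mod_cast h3
  have h5 : ((p : ℤ) : ℝ) ≤ ((|(k : ℚ).num| : ℤ) : ℝ) := by exact_mod_cast h2
  rw [Int.cast_natCast] at h5
  linarith

theorem logAbs_eq {k : ℚˣ} (hk : k ∈ boundedFractions p p) :
    logAbs p k = denExponent p k * Real.log p := by
  unfold logAbs
  rw [padicNorm.eq_zpow_of_nonzero k.ne_zero, padicValRat_def,
    padicValInt.eq_zero_of_not_dvd (not_dvd_num hk)]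
  simp [denExponent]

variable (p) in
/-- The fraction `n / p ^ j` as an invertible element. -/
def fractionUnit (j : ℕ) (n : ℤ) (hn : n ≠ 0) : ℚˣ :=
  Units.mk0 ((n : ℚ) / (p : ℚ) ^ j)
    (div_ne_zero (by exact_mod_cast hn) (pow_ne_zero _ (by exact_mod_cast hp.out.ne_zero)))

theorem den_fractionUnit_dvd (j : ℕ) (n : ℤ) (hn : n ≠ 0) :
    (fractionUnit p j n hn : ℚ).den ∣ p ^ j := by
  have h := Rat.den_dvd n ((p ^ j : ℕ) : ℤ)
  rw [Rat.divInt_eq_div] at h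
  have e : (fractionUnit p j n hn : ℚ) = (n : ℚ) / (((p ^ j : ℕ) : ℤ) : ℚ) := by
    simp [fractionUnit]
  rw [e]
  exact_mod_cast h

/-- The largest integer strictly below `x` is `⌈x - 1⌉`; this is the origin of the ceilings in the
digits, and the strict inequality selects the non-terminating expansion. -/
theorem abs_lt_iff_mem_Icc (x : ℝ) (n : ℤ) :
    |(n : ℝ)| < x ↔ n ∈ Finset.Icc (-⌈x - 1⌉) ⌈x - 1⌉ := by
  rw [Finset.mem_Icc, ← abs_le, Int.ceil_sub_one, Int.le_sub_one_iff, Int.lt_ceil, Int.cast_abs]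

/-- Multiplication by `p^j` identifies the fractions whose denominator divides `p^j` with the
nonzero integers of absolute value less than `λp^j`. The sum of the indicator is their number. -/
theorem hasSum_indicator_denExponent (h1 : 1 < lam) (j : ℕ) :
    HasSum (fun k : boundedFractions p lam => if denExponent p k ≤ j then (1 : ℝ) else 0)
      (2 * ⌈lam * (p : ℝ) ^ j - 1⌉) := by
  have hp0 : (0 : ℝ) < p := by exact_mod_cast hp.out.pos
  set N := ⌈lam * (p : ℝ) ^ j - 1⌉ with hN
  have hN0 : 0 ≤ N := by
    refine Int.ceil_nonneg ?_
    have : (1 : ℝ) ≤ (p : ℝ) ^ j := one_le_pow₀ (by exact_mod_cast hp.out.one_le)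
    nlinarith
  let T := (Finset.Icc (-N) N).erase 0
  have hT : (T.card : ℝ) = 2 * N := by
    have h0 : (T.card : ℤ) = 2 * N := by
      rw [Finset.card_erase_of_mem (by simp [hN0]), Int.card_Icc]
      omega
    exact_mod_cast h0
  have hmem : ∀ n : T, fractionUnit p j n (Finset.ne_of_mem_erase n.2) ∈ boundedFractions p lam := by
    rintro ⟨n, hn⟩
    refine ⟨fun q hq hne hd => hne ?_, ?_⟩
    · exact (Nat.prime_dvd_prime_iff_eq hq hp.out).1
        (hq.dvd_of_dvd_pow (hd.trans (den_fractionUnit_dvd j n _)))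
    · have := (abs_lt_iff_mem_Icc (lam * (p : ℝ) ^ j) n).2 (Finset.mem_of_mem_erase hn)
      simp only [fractionUnit, Units.val_mk0, Rat.cast_div, Rat.cast_intCast, Rat.cast_pow,
        Rat.cast_natCast, abs_div, abs_pow, Nat.abs_cast]
      rwa [div_lt_iff₀ (by positivity)]
  let φ : T → boundedFractions p lam := fun n => ⟨_, hmem n⟩
  have hφ : Function.Injective φ := by
    rintro ⟨m, hm⟩ ⟨n, hn⟩ h
    have h' : (m : ℚ) / (p : ℚ) ^ j = (n : ℚ) / (p : ℚ) ^ j :=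
      congrArg (fun k : boundedFractions p lam => ((k : ℚˣ) : ℚ)) h
    have hne : ((p : ℚ) ^ j) ≠ 0 := pow_ne_zero _ (by exact_mod_cast hp.out.ne_zero)
    rw [div_left_inj' hne] at h'
    have h'' : m = n := by exact_mod_cast h'
    exact Subtype.ext h''
  -- The fraction `n / p^j` need not be in lowest terms, so its exponent is only at most `j`.
  have hle : ∀ n, denExponent p (φ n) ≤ j := by
    intro n
    refine (Nat.pow_dvd_pow_iff_le_right hp.out.one_lt).1 ?_
    rw [← den_eq_pow_denExponent (φ n).2]
    exact den_fractionUnit_dvd j n.1 (Finset.ne_of_mem_erase n.2)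
  rw [← hφ.hasSum_iff]
  · have e : ((fun k : boundedFractions p lam => if denExponent p k ≤ j then (1 : ℝ) else 0) ∘ φ) =
        fun _ => 1 := funext fun n => if_pos (hle n)
    rw [e]
    convert hasSum_fintype (fun _ : T => (1 : ℝ)) using 1
    simp [hT]
  · intro k hk
    refine if_neg fun hj => hk ?_
    have hne : ((p : ℚ) ^ j) ≠ 0 := pow_ne_zero _ (by exact_mod_cast hp.out.ne_zero)
    -- The cofactor `c` expands `k` to a fraction with denominator exactly `p^j`.
    obtain ⟨c, hc⟩ : ((k : ℚˣ) : ℚ).den ∣ p ^ j := by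
      rw [den_eq_pow_denExponent k.2]
      exact pow_dvd_pow _ hj
    have hkc : ((k : ℚˣ) : ℚ) = (((k : ℚˣ) : ℚ).num * c : ℤ) / (p : ℚ) ^ j := by
      rw [eq_div_iff hne]
      have : ((p : ℚ) ^ j) = ((k : ℚˣ) : ℚ).den * c := by exact_mod_cast hc
      rw [this, ← mul_assoc, Rat.mul_den_eq_num]
      push_cast
      ring
    set n := ((k : ℚˣ) : ℚ).num * (c : ℤ) with hn
    have hn0 : n ≠ 0 := fun h => k.1.ne_zero (by rw [hkc, h]; simp)
    have hnT : n ∈ T := by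
      refine Finset.mem_erase.2 ⟨hn0, (abs_lt_iff_mem_Icc _ n).1 ?_⟩
      have := k.2.2
      rw [hkc, Rat.cast_div, Rat.cast_intCast, Rat.cast_pow, Rat.cast_natCast, abs_div, abs_pow,
        Nat.abs_cast, div_lt_iff₀ (by positivity)] at this
      exact this
    exact ⟨⟨n, hnT⟩, Subtype.ext (Units.ext hkc.symm)⟩

/-- With `N_j = ⌈λp^j - 1⌉` the digits are `c_j = N_j - p N_{j-1}` with `N_{-1} = 0`, so their
generating function is `1 - pq` times that of the `N_j`. Convergence follows from `0 ≤ N_j ≤ λp^j`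
and `pq < 1`. -/
theorem hasSum_ceil_mul_pow (h1 : 1 < lam) (h2 : lam ≤ p) {q : ℝ} (hq0 : 0 < q) (hq : p * q < 1) :
    HasSum (fun j : ℕ => (⌈lam * (p : ℝ) ^ j - 1⌉ : ℝ) * q ^ j)
      ((1 - p * q)⁻¹ * ∑' j, (digit p lam j : ℝ) * q ^ j) := by
  have hp0 : (0 : ℝ) < p := by exact_mod_cast hp.out.pos
  set a : ℕ → ℝ := fun j => (⌈lam * (p : ℝ) ^ j - 1⌉ : ℝ) * q ^ j with ha
  have hs : Summable a := by
    refine ((summable_geometric_of_lt_one (by positivity) hq).mul_left lam).of_nonneg_of_le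
      (fun j => ?_) fun j => ?_
    · have h3 : 0 ≤ ⌈lam * (p : ℝ) ^ j - 1⌉ := by
        refine Int.ceil_nonneg ?_
        have : (1 : ℝ) ≤ (p : ℝ) ^ j := one_le_pow₀ (by exact_mod_cast hp.out.one_le)
        nlinarith
      have h4 : (0 : ℝ) ≤ ⌈lam * (p : ℝ) ^ j - 1⌉ := by exact_mod_cast h3
      positivity
    · have h3 := Int.ceil_lt_add_one (lam * (p : ℝ) ^ j - 1)
      have h4 : (0 : ℝ) < q ^ j := by positivity
      rw [mul_pow, ← mul_assoc]
      refine mul_le_mul_of_nonneg_right ?_ h4.le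
      linarith
  have hdig : ∀ j, (digit p lam (j + 1) : ℝ) * q ^ (j + 1) = a (j + 1) - p * q * a j := by
    intro j
    have : ((j + 1 : ℕ) : ℤ) - 1 = (j : ℕ) := by push_cast; ring
    simp only [digit, this, ha, zpow_natCast]
    push_cast
    ring
  have hdig0 : (digit p lam 0 : ℝ) * q ^ 0 = a 0 := by
    -- This is `N_{-1} = 0`: as `0 < λ/p ≤ 1`, the number `λ/p - 1` lies in `(-1, 0]`.
    have : ⌈lam * (p : ℝ) ^ (((0 : ℕ) : ℤ) - 1) - 1⌉ = 0 := by
      rw [Int.ceil_eq_iff]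
      have : 0 < lam / p := by positivity
      have : lam / p ≤ 1 := (div_le_one hp0).mpr h2
      simp only [Nat.cast_zero, zero_sub, zpow_neg_one, ← div_eq_mul_inv]
      push_cast
      constructor <;> linarith
    simp only [digit, this, ha, zpow_natCast]
    simp
  have hs1 : Summable fun j => a (j + 1) := (summable_nat_add_iff 1).2 hs
  have hsd : Summable fun j => (digit p lam j : ℝ) * q ^ j := by
    rw [← summable_nat_add_iff 1]
    simp only [hdig]
    exact hs1.sub (hs.mul_left _)
  have hkey : ∑' j, (digit p lam j : ℝ) * q ^ j = (1 - p * q) * ∑' j, a j := by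
    rw [hsd.tsum_eq_zero_add, hdig0]
    simp only [hdig]
    rw [hs1.tsum_sub (hs.mul_left _), tsum_mul_left, hs.tsum_eq_zero_add]
    ring
  rw [hkey, inv_mul_cancel_left₀ (by linarith)]
  exact hs.hasSum

/-- This is summation by parts: it writes `q^e` through the indicators of `e ≤ j`, so that only the
cumulative counts of `hasSum_indicator_denExponent` are needed. -/
theorem hasSum_geometric_tail {q : ℝ} (hq0 : 0 < q) (hq1 : q < 1) (e : ℕ) :
    HasSum (fun j : ℕ => ((1 - q) * q ^ j) * if e ≤ j then 1 else 0) (q ^ e) := by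
  rw [← (add_left_injective e).hasSum_iff]
  · have h3 := (hasSum_geometric_of_lt_one hq0.le hq1).mul_left ((1 - q) * q ^ e)
    have h4 : (1 - q) * q ^ e * (1 - q)⁻¹ = q ^ e := by
      have : 1 - q ≠ 0 := by linarith
      field_simp
    rw [h4] at h3
    refine h3.congr_fun fun j => ?_
    simp only [Function.comp_apply]
    rw [if_pos (Nat.le_add_left e j), pow_add]
    ring
  · intro j hj
    rw [if_neg, mul_zero]
    exact fun hle => hj ⟨j - e, Nat.sub_add_cancel hle⟩

/-- A form of Tonelli's theorem in which the summability of the column sums is a conclusion and not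
a hypothesis. -/
theorem hasSum_comm_of_nonneg {α γ : Type*} {G : α → γ → ℝ} (h0 : ∀ a b, 0 ≤ G a b)
    {R : α → ℝ} {C : γ → ℝ} {s : ℝ} (hrow : ∀ a, HasSum (fun b => G a b) (R a))
    (hcol : ∀ b, HasSum (fun a => G a b) (C b)) (htot : HasSum R s) : HasSum C s := by
  have hG : Summable fun x : α × γ => G x.1 x.2 := by
    rw [summable_prod_of_nonneg fun x => h0 x.1 x.2]
    refine ⟨fun a => (hrow a).summable, ?_⟩
    simp only [(hrow _).tsum_eq]
    exact htot.summable
  have hswap : HasSum (fun x : γ × α => G x.2 x.1) (∑' x : α × γ, G x.1 x.2) :=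
    (Equiv.prodComm γ α).hasSum_iff.mpr hG.hasSum
  have h3 := hswap.prod_fiberwise hcol
  rwa [(hG.hasSum.prod_fiberwise hrow).unique htot] at h3

theorem hasSum_pow_denExponent (h1 : 1 < lam) (h2 : lam ≤ p) {q : ℝ} (hq0 : 0 < q)
    (hq : p * q < 1) :
    HasSum (fun k : boundedFractions p lam => q ^ denExponent p k)
      (2 * ((1 - q) / (1 - p * q)) * ∑' j, (digit p lam j : ℝ) * q ^ j) := by
  have hp1 : (1 : ℝ) ≤ p := by exact_mod_cast hp.out.one_le
  have hq1 : q < 1 := by nlinarith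
  have htot : HasSum (fun j : ℕ => ((1 - q) * q ^ j) * (2 * (⌈lam * (p : ℝ) ^ j - 1⌉ : ℝ)))
      (2 * ((1 - q) / (1 - p * q)) * ∑' j, (digit p lam j : ℝ) * q ^ j) := by
    have h3 := (hasSum_ceil_mul_pow h1 h2 hq0 hq).mul_left (2 * (1 - q))
    rw [← mul_assoc, ← div_eq_mul_inv, mul_div_assoc] at h3
    exact h3.congr_fun fun j => by ring
  refine hasSum_comm_of_nonneg
    (G := fun j (k : boundedFractions p lam) =>
      ((1 - q) * q ^ j) * if denExponent p k ≤ j then 1 else 0) (fun j k => ?_)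
    (fun j => (hasSum_indicator_denExponent h1 j).mul_left _)
    (fun k => hasSum_geometric_tail hq0 hq1 _) htot
  have h3 : 0 ≤ (1 - q) * q ^ j := mul_nonneg (by linarith) (by positivity)
  exact mul_nonneg h3 (by split_ifs <;> simp)

theorem exp_neg_mul_logAbs {k : ℚˣ} (hk : k ∈ boundedFractions p p) (β : ℝ) :
    Real.exp (-β * logAbs p k) = ((p : ℝ) ^ (-β)) ^ denExponent p k := by
  have hp0 : (0 : ℝ) < p := by exact_mod_cast hp.out.pos
  rw [logAbs_eq hk, Real.rpow_def_of_pos hp0, ← Real.exp_nat_mul]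
  congr 1
  ring

/-- The count is evaluated at `q = p^{-β}`, for which `β > 1` yields the convergence condition `pq <
1`. -/
theorem hasSum_exp_neg_mul_logAbs (h1 : 1 < lam) (h2 : lam ≤ p) {β : ℝ} (hβ : 1 < β) :
    HasSum (fun k : boundedFractions p lam => Real.exp (-β * logAbs p k))
      (partitionFunction p lam β) := by
  have hp0 : (0 : ℝ) < p := by exact_mod_cast hp.out.pos
  have hp1 : (1 : ℝ) < p := by exact_mod_cast hp.out.one_lt
  have e1 : (p : ℝ) * (p : ℝ) ^ (-β) = (p : ℝ) ^ (1 - β) := by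
    rw [sub_eq_add_neg, Real.rpow_add hp0, Real.rpow_one]
  have e2 : (p : ℝ) * (p : ℝ) ^ (-β) < 1 := by
    rw [e1]
    exact Real.rpow_lt_one_of_one_lt_of_neg hp1 (by linarith)
  have h := hasSum_pow_denExponent h1 h2 (Real.rpow_pos_of_pos hp0 (-β)) e2
  rw [e1] at h
  have e3 : digitSum p lam β = ∑' j, (digit p lam j : ℝ) * ((p : ℝ) ^ (-β)) ^ j := by
    refine tsum_congr fun j => ?_
    rw [← Real.rpow_natCast, ← Real.rpow_mul hp0.le]
    congr 2
    ring
  unfold partitionFunction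
  rw [e3]
  exact h.congr_fun fun k => exp_neg_mul_logAbs (boundedFractions_mono h2 k.2) β

/-- The value `j log p` is attained at `p^{-j}`, which is admissible because `p^{-j} ≤ 1 < λ`. -/
theorem range_logAbs (h1 : 1 < lam) (h2 : lam ≤ p) :
    (Set.range fun k : boundedFractions p lam => logAbs p k) =
      Set.range fun j : ℕ => (j * Real.log p : ℝ) := by
  have hp0 : (0 : ℝ) < p := by exact_mod_cast hp.out.pos
  ext x
  constructor
  · rintro ⟨k, rfl⟩
    exact ⟨denExponent p k, (logAbs_eq (boundedFractions_mono h2 k.2)).symm⟩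
  · rintro ⟨j, rfl⟩
    refine ⟨⟨fractionUnit p j 1 one_ne_zero, fun q hq hne hd => hne ?_, ?_⟩, ?_⟩
    · exact (Nat.prime_dvd_prime_iff_eq hq hp.out).1
        (hq.dvd_of_dvd_pow (hd.trans (den_fractionUnit_dvd j 1 _)))
    · have h3 : (1 : ℝ) ≤ (p : ℝ) ^ j := one_le_pow₀ (by exact_mod_cast hp.out.one_le)
      simp only [fractionUnit, Units.val_mk0, Rat.cast_div, Rat.cast_pow, Rat.cast_natCast,
        abs_div, abs_pow, Nat.abs_cast, Int.cast_one]
      refine lt_of_le_of_lt ?_ h1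
      rw [div_le_one (by positivity)]
      simpa using h3
    · change logAbs p (fractionUnit p j 1 one_ne_zero) = _
      unfold logAbs
      have h3 : padicNorm p ((p : ℚ) ^ j) = (p : ℚ)⁻¹ ^ j := by
        induction j with
        | zero => simp
        | succ j ih => rw [pow_succ, padicNorm.mul, ih, padicNorm.padicNorm_p_of_prime, pow_succ]
      simp only [fractionUnit, Units.val_mk0, padicNorm.div, Int.cast_one, padicNorm.one, h3]
      simp

end Counting

/-! ### The topology of the space of units -/

section AdeleTopology

open NumberField IsDedekindDomain

/-- Compactness is transported from `ℤ_p` along the isomorphism of the completion with the `p`-adic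
numbers. It yields the local compactness of the adeles, needed for the Urysohn functions in
`exists_unit_bump`. -/
theorem isCompact_adicCompletionIntegers (w : HeightOneSpectrum ℤ) :
    IsCompact (w.adicCompletionIntegers ℚ : Set (w.adicCompletion ℚ)) := by
  have : Fact (Rat.HeightOneSpectrum.primesEquiv w : ℕ).Prime :=
    ⟨(Rat.HeightOneSpectrum.primesEquiv w).2⟩
  let e := (Rat.HeightOneSpectrum.adicCompletion.padicEquiv w).toHomeomorph
  have h1 : IsCompact (PadicInt.subring (Rat.HeightOneSpectrum.primesEquiv w) : Set
      ℚ_[Rat.HeightOneSpectrum.primesEquiv w]) :=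
    isCompact_iff_compactSpace.2 (PadicInt.compactSpace _)
  have h2 := (Rat.HeightOneSpectrum.adicCompletion.padicEquiv_bijOn w).image_eq
  rw [← e.isCompact_image]
  exact h2 ▸ h1

theorem isOpen_adicCompletionIntegers (w : HeightOneSpectrum ℤ) :
    IsOpen (w.adicCompletionIntegers ℚ : Set (w.adicCompletion ℚ)) :=
  Valued.isOpen_valuationSubring _

instance locallyCompactSpace_finiteAdeleRing : LocallyCompactSpace (FiniteAdeleRing ℤ ℚ) := by
  have : Fact (∀ w : HeightOneSpectrum ℤ,
      IsOpen (w.adicCompletionIntegers ℚ : Set (w.adicCompletion ℚ))) :=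
    ⟨isOpen_adicCompletionIntegers⟩
  have : ∀ w : HeightOneSpectrum ℤ, CompactSpace (w.adicCompletionIntegers ℚ) :=
    fun w => isCompact_iff_compactSpace.1 (isCompact_adicCompletionIntegers w)
  exact inferInstanceAs (LocallyCompactSpace (RestrictedProduct
    (fun w : HeightOneSpectrum ℤ => w.adicCompletion ℚ)
    (fun w => (w.adicCompletionIntegers ℚ : Set (w.adicCompletion ℚ))) cofinite))

instance t2Space_finiteAdeleRing : T2Space (FiniteAdeleRing ℤ ℚ) :=
  inferInstanceAs (T2Space (RestrictedProduct
    (fun w : HeightOneSpectrum ℤ => w.adicCompletion ℚ)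
    (fun w => (w.adicCompletionIntegers ℚ : Set (w.adicCompletion ℚ))) cofinite))

instance locallyCompactSpace_adeleRing : LocallyCompactSpace (AdeleRing ℤ ℚ) :=
  inferInstanceAs (LocallyCompactSpace (InfiniteAdeleRing ℚ × FiniteAdeleRing ℤ ℚ))

instance t2Space_adeleRing : T2Space (AdeleRing ℤ ℚ) :=
  have : T2Space (InfiniteAdeleRing ℚ) :=
    inferInstanceAs (T2Space ((v : InfinitePlace ℚ) → v.Completion))
  inferInstanceAs (T2Space (InfiniteAdeleRing ℚ × FiniteAdeleRing ℤ ℚ))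

theorem continuous_finite_component (w : HeightOneSpectrum ℤ) :
    Continuous fun a : AdeleRing ℤ ℚ => a.2 w :=
  (RestrictedProduct.continuous_eval (R := fun w : HeightOneSpectrum ℤ => w.adicCompletion ℚ)
    (A := fun w => (w.adicCompletionIntegers ℚ : Set (w.adicCompletion ℚ))) w).comp
    (continuous_snd : Continuous fun a : InfiniteAdeleRing ℚ × FiniteAdeleRing ℤ ℚ => a.2)

variable {p : ℕ} [hp : Fact p.Prime]

instance : T2Space (AdeleAt p) :=
  inferInstanceAs (T2Space {a : AdeleRing ℤ ℚ // a.2 (place p) = 0})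

instance : LocallyCompactSpace (AdeleAt p) := by
  have h : IsClosed {a : AdeleRing ℤ ℚ | a.2 (place p) = 0} :=
    isClosed_eq (continuous_finite_component _) continuous_const
  exact h.isClosedEmbedding_subtypeVal.locallyCompactSpace

theorem continuous_absInf : Continuous (absInf : AdeleAt p → ℝ) := by
  have h1 : Continuous fun a : InfiniteAdeleRing ℚ × FiniteAdeleRing ℤ ℚ =>
      a.1 Rat.infinitePlace := (continuous_apply Rat.infinitePlace).comp continuous_fst
  exact (h1.comp (continuous_subtype_val (p := fun a : AdeleRing ℤ ℚ => a.2 (place p) = 0))).norm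

theorem isOpen_openBox : IsOpen (openBox p) := by
  have h1 : IsOpen {a : FiniteAdeleRing ℤ ℚ | ∀ w, a w ∈ w.adicCompletionIntegers ℚ} :=
    RestrictedProduct.isOpen_forall_mem (R := fun w : HeightOneSpectrum ℤ => w.adicCompletion ℚ)
      (A := fun w => (w.adicCompletionIntegers ℚ : Set (w.adicCompletion ℚ)))
      isOpen_adicCompletionIntegers
  have h2 : Continuous fun a : AdeleAt p => a.1.2 :=
    (continuous_snd (X := InfiniteAdeleRing ℚ) (Y := FiniteAdeleRing ℤ ℚ)).comp
      (continuous_subtype_val (p := fun a : AdeleRing ℤ ℚ => a.2 (place p) = 0))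
  exact (isOpen_lt continuous_absInf continuous_const).inter (h1.preimage h2)

theorem absInf_smul (k : ℚˣ) (y : AdeleAt p) : absInf (k • y) = |((k : ℚ) : ℝ)| * absInf y := by
  have h1 : (algebraMap ℚ (AdeleRing ℤ ℚ) k).1 Rat.infinitePlace =
      ((k : ℚ) : Rat.infinitePlace.Completion) :=
    eq_ratCast (algebraMap ℚ Rat.infinitePlace.Completion) _
  have h2 : absInf (k • y) =
      ‖(algebraMap ℚ (AdeleRing ℤ ℚ) k).1 Rat.infinitePlace * y.1.1 Rat.infinitePlace‖ := rfl
  rw [h2, norm_mul, h1, InfinitePlace.Completion.Rat.norm_infinitePlace_completion, Rat.cast_abs]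
  rfl

theorem valued_smul (k : ℚˣ) (y : AdeleAt p) (w : HeightOneSpectrum ℤ) :
    Valued.v ((k • y).1.2 w) = w.valuation ℚ (k : ℚ) * Valued.v (y.1.2 w) := by
  have h : (k • y).1.2 w = (algebraMap ℚ (AdeleRing ℤ ℚ) k).2 w * y.1.2 w := rfl
  rw [h, map_mul]
  congr 1
  exact w.valuedAdicCompletion_eq_valuation' (k : ℚ)

theorem valuation_le_one_iff_not_dvd_den (w : HeightOneSpectrum ℤ) (x : ℚ) :
    w.valuation ℚ x ≤ 1 ↔ ¬ (Rat.HeightOneSpectrum.primesEquiv w : ℕ) ∣ x.den := by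
  have : Fact (Rat.HeightOneSpectrum.primesEquiv w : ℕ).Prime :=
    ⟨(Rat.HeightOneSpectrum.primesEquiv w).2⟩
  rw [(Rat.HeightOneSpectrum.valuation_equiv_padicValuation w).le_one_iff_le_one]
  exact Rat.padicValuation_le_one_iff

theorem absInf_pos {y : AdeleAt p} (hy : y ∈ unitBox p) : 0 < absInf y :=
  lt_of_lt_of_le (inv_pos.2 (by exact_mod_cast hp.out.pos)) hy.2.1

theorem one_lt_inv_absInf {y : AdeleAt p} (hy : y ∈ unitBox p) : 1 < (absInf y)⁻¹ :=
  (one_lt_inv₀ (absInf_pos hy)).2 hy.2.2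

theorem inv_absInf_le {y : AdeleAt p} (hy : y ∈ unitBox p) : (absInf y)⁻¹ ≤ p :=
  inv_le_of_inv_le₀ (by exact_mod_cast hp.out.pos) hy.2.1

/-- The conditions separate by place, and where `|y_w| = 1` they concern `k` alone. -/
theorem smul_mem_openBox_iff {y : AdeleAt p} (hy : y ∈ unitBox p) (k : ℚˣ) :
    k • y ∈ openBox p ↔ k ∈ boundedFractions p (absInf y)⁻¹ := by
  have h1 : absInf (k • y) < 1 ↔ |((k : ℚ) : ℝ)| < (absInf y)⁻¹ := by
    rw [absInf_smul, inv_eq_one_div, lt_div_iff₀ (absInf_pos hy)]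
  have h2 : (∀ w : HeightOneSpectrum ℤ, Valued.v ((k • y).1.2 w) ≤ 1) ↔
      ∀ q : ℕ, q.Prime → q ≠ p → ¬ q ∣ (k : ℚ).den := by
    constructor
    · intro H q hq hne
      set w : HeightOneSpectrum ℤ := Rat.HeightOneSpectrum.primesEquiv.symm ⟨q, hq⟩
      have hwp : w ≠ place p := fun h => hne (congrArg Subtype.val
        (Rat.HeightOneSpectrum.primesEquiv.symm.injective h))
      have h3 := H w
      have h4 : (Rat.HeightOneSpectrum.primesEquiv w : ℕ) = q :=
        congrArg Subtype.val (Rat.HeightOneSpectrum.primesEquiv.apply_symm_apply ⟨q, hq⟩)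
      rwa [valued_smul, hy.1 w hwp, mul_one, valuation_le_one_iff_not_dvd_den, h4] at h3
    · intro H w
      rw [valued_smul]
      by_cases hwp : w = place p
      -- The component at `p` vanishes, so powers of `p` are allowed in the denominator of `k`.
      · rw [hwp, y.2, map_zero, mul_zero]
        exact zero_le_one
      · rw [hy.1 w hwp, mul_one, valuation_le_one_iff_not_dvd_den]
        refine H _ (Rat.HeightOneSpectrum.primesEquiv w).2 fun h => hwp ?_
        exact (Equiv.eq_symm_apply _).2 (Subtype.ext h)
  exact (and_congr h1 h2).trans and_comm

end AdeleTopology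

/-! ### The representation and the Hamiltonian on an orbit -/

section Orbits

variable {p : ℕ} [hp : Fact p.Prime]

theorem continuous_rep (y : AdeleAt p) : Continuous fun a => rep y a :=
  AddMonoidHomClass.continuous_of_bound (rep y) 1 fun a => by
    rw [one_mul]
    exact NonUnitalStarAlgHom.norm_apply_le (rep y) a

theorem continuous_evolution (t : ℝ) : Continuous fun a : Alg p => evolution p t a :=
  AddMonoidHomClass.continuous_of_bound (evolution p t) 1 fun a => by
    rw [one_mul]
    exact NonUnitalStarAlgHom.norm_apply_le (evolution p t) a

theorem rep_of (y : AdeleAt p) (f : Cc ℚˣ (AdeleAt p) (openBox p)) :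
    rep y (CStar.of f) = regOp y f := regRep_of y f

theorem coe_timeChar (t : ℝ) (k : ℚˣ) :
    (timeChar p t k : ℂ) = Complex.exp (Complex.I * (t * logAbs p k : ℝ)) := by
  rw [mul_comm]
  exact Circle.coe_exp _

/-- The operator `e^{itH}` implements the time evolution in the representation `π_y`. -/
theorem rep_evolution (y : AdeleAt p) (t : ℝ) (a : Alg p) :
    rep y (evolution p t a) = expMul (fun k : Orbit y => logAbs p k.1) t * rep y a *
      expMul (fun k : Orbit y => logAbs p k.1) (-t) := by
  refine CStar.induction_on a (isClosed_eq ((continuous_rep y).comp (continuous_evolution t))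
    ((continuous_const.mul (continuous_rep y)).mul continuous_const)) fun f => ?_
  rw [show evolution p t (CStar.of f) = CStar.of (Cc.twist (timeChar p t) f) from
    CStar.twist_of _ f, rep_of, rep_of]
  ext ξ k
  rw [mul_apply_eq_comp, mul_apply_eq_comp, expMul_apply, regOp_apply, regOp_apply,
    ← coe_timeChar]
  unfold act
  rw [← smul_eq_mul, smul_finsum]
  refine finsum_congr fun s => ?_
  change (timeChar p t (k.1 * s⁻¹) : ℂ) * f (k.1 * s⁻¹) (s • y) * extZero ξ s =
    (timeChar p t k.1 : ℂ) * (f (k.1 * s⁻¹) (s • y) *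
      extZero (expMul (fun k : Orbit y => logAbs p k.1) (-t) ξ) s)
  -- On the orbit, `χ(k s⁻¹) = χ(k) χ(s)⁻¹` distributes the character over the two unitaries; off
  -- the orbit both terms vanish by the extension by zero.
  by_cases hs : s • y ∈ openBox p
  · have h1 := fun ζ : EllTwo (Orbit y) => extZero_coe ζ ⟨s, hs⟩
    simp only at h1
    have h2 : (timeChar p t (k.1 * s⁻¹) : ℂ) =
        timeChar p t k.1 * Complex.exp (Complex.I * (-t * logAbs p s : ℝ)) := by
      rw [map_mul, Circle.coe_mul, ← coe_timeChar (p := p) (-t) s]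
      congr 2
      rw [map_inv]
      change (Circle.exp (t * logAbs p s))⁻¹ = Circle.exp (-t * logAbs p s)
      rw [neg_mul, Circle.exp_neg]
    rw [h1, h1, expMul_apply, h2]
    ring
  · rw [extZero_of_notMem _ hs, extZero_of_notMem _ hs]
    simp

/-- Only `s = k` contributes, so the diagonal of `π_y(f)`, and with it the Gibbs functional, depends
only on the restriction of `f` to the units. -/
theorem regOp_basisVec_self (y : AdeleAt p) (f : Cc ℚˣ (AdeleAt p) (openBox p)) (k : Orbit y) :
    regOp y f (basisVec k) k = f 1 (k.1 • y) := by
  rw [regOp_apply]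
  unfold act
  rw [finsum_eq_single _ k.1]
  · rw [extZero_coe, basisVec_self, mul_inv_cancel, mul_one]
  · intro s hs
    by_cases h : s • y ∈ openBox p
    · have h1 := extZero_coe (basisVec k) (⟨s, h⟩ : Orbit y)
      simp only at h1
      rw [h1, basisVec_ne fun e => hs (congrArg Subtype.val e), mul_zero]
    · rw [extZero_of_notMem _ h, mul_zero]

theorem mem_boundedFractions_of_mem_orbit {y : AdeleAt p} (hy : y ∈ unitBox p) {k : ℚˣ}
    (hk : k • y ∈ openBox p) : k ∈ boundedFractions p p :=
  boundedFractions_mono (inv_absInf_le hy) ((smul_mem_openBox_iff hy k).1 hk)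

theorem logAbs_nonneg {k : ℚˣ} (hk : k ∈ boundedFractions p p) : 0 ≤ logAbs p k := by
  rw [logAbs_eq hk]
  exact mul_nonneg (Nat.cast_nonneg _) (Real.log_natCast_nonneg p)

theorem hasSum_orbit {y : AdeleAt p} (hy : y ∈ unitBox p) {β : ℝ} (hβ : 1 < β) :
    HasSum (fun k : Orbit y => Real.exp (-β * logAbs p k.1))
      (partitionFunction p (absInf y)⁻¹ β) :=
  (Equiv.subtypeEquivRight (smul_mem_openBox_iff hy)).hasSum_iff.mpr
    (hasSum_exp_neg_mul_logAbs (one_lt_inv_absInf hy) (inv_absInf_le hy) hβ)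

/-- The case `λ = p` contains every orbit and supplies the majorant that is uniform in `y`. -/
theorem hasSum_boundedFractions {β : ℝ} (hβ : 1 < β) :
    HasSum (fun k : boundedFractions p p => Real.exp (-β * logAbs p k))
      (partitionFunction p p β) :=
  hasSum_exp_neg_mul_logAbs (by exact_mod_cast hp.out.one_lt) le_rfl hβ

theorem partitionFunction_le {y : AdeleAt p} (hy : y ∈ unitBox p) {β : ℝ} (hβ : 1 < β) :
    partitionFunction p (absInf y)⁻¹ β ≤ partitionFunction p p β := by
  have hsub : {k : ℚˣ | k • y ∈ openBox p} ⊆ boundedFractions p p :=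
    fun k hk => mem_boundedFractions_of_mem_orbit hy hk
  have h1 : ∀ k : boundedFractions p p, k ∉ Set.range (Set.inclusion hsub) →
      0 ≤ Real.exp (-β * logAbs p k) := fun k _ => (Real.exp_pos _).le
  have h2 : ∀ k : {k : ℚˣ | k • y ∈ openBox p}, Real.exp (-β * logAbs p k) ≤
      Real.exp (-β * logAbs p (Set.inclusion hsub k)) := fun k => le_rfl
  exact hasSum_le_inj (Set.inclusion hsub) (Set.inclusion_injective hsub) h1 h2
    (hasSum_orbit hy hβ) (hasSum_boundedFractions hβ)

theorem norm_exp_neg_le {y : AdeleAt p} (hy : y ∈ unitBox p) {β : ℝ} (hβ : 1 < β) (k : Orbit y) :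
    ‖(Real.exp (-β * logAbs p k.1) : ℂ)‖ ≤ 1 := by
  rw [Complex.norm_real, Real.norm_of_nonneg (Real.exp_pos _).le, Real.exp_le_one_iff]
  nlinarith [logAbs_nonneg (mem_boundedFractions_of_mem_orbit hy k.2)]

theorem expNegHamiltonian_eq {y : AdeleAt p} (hy : y ∈ unitBox p) {β : ℝ} (hβ : 1 < β) :
    expNegHamiltonian β y = mulCLM _ (norm_exp_neg_le hy hβ) :=
  boundedMulOp_eq _ _

theorem hasTrace_expNegHamiltonian_mul {y : AdeleAt p} (hy : y ∈ unitBox p) {β : ℝ} (hβ : 1 < β)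
    (A : EllTwo (Orbit y) →L[ℂ] EllTwo (Orbit y)) :
    HasTrace (expNegHamiltonian β y * A)
      (∑' k : Orbit y, (Real.exp (-β * logAbs p k.1) : ℂ) * A (basisVec k) k) := by
  rw [expNegHamiltonian_eq hy hβ]
  exact hasTrace_mulCLM_mul (hasSum_orbit hy hβ).summable (fun _ => (Real.exp_pos _).le) _ A

theorem hasTrace_expNegHamiltonian {y : AdeleAt p} (hy : y ∈ unitBox p) {β : ℝ} (hβ : 1 < β) :
    HasTrace (expNegHamiltonian β y) (partitionFunction p (absInf y)⁻¹ β : ℂ) := by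
  have h := hasTrace_expNegHamiltonian_mul hy hβ 1
  rw [mul_one] at h
  convert h
  rw [← (hasSum_orbit hy hβ).tsum_eq, Complex.ofReal_tsum]
  exact tsum_congr fun k => by simp

theorem range_logAbs_orbit {y : AdeleAt p} (hy : y ∈ unitBox p) :
    (Set.range fun k : Orbit y => (logAbs p k.1 : ℂ)) =
      Set.range fun k : ℕ => ((k * Real.log p : ℝ) : ℂ) := by
  have h1 : (Set.range fun k : Orbit y => logAbs p k.1) =
      Set.range fun k : ℕ => (k * Real.log p : ℝ) := by
    rw [← range_logAbs (one_lt_inv_absInf hy) (inv_absInf_le hy)]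
    exact (Equiv.subtypeEquivRight (smul_mem_openBox_iff hy)).surjective.range_comp
      (fun k : boundedFractions p (absInf y)⁻¹ => logAbs p k)
  have h2 := congrArg (fun s : Set ℝ => Complex.ofReal '' s) h1
  simpa only [← Set.range_comp, Function.comp_def] using h2

theorem isClosed_range_nat_mul {c : ℝ} (hc : c ≠ 0) :
    IsClosed (Set.range fun k : ℕ => ((k * c : ℝ) : ℂ)) :=
  (Complex.isometry_ofReal.isClosedEmbedding.comp
    ((Homeomorph.mulRight₀ c hc).isClosedEmbedding.comp Nat.isClosedEmbedding_coe_real)).isClosed_range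

theorem unboundedSpectrum_hamiltonian {y : AdeleAt p} (hy : y ∈ unitBox p) :
    unboundedSpectrum (hamiltonian y) = Set.range fun k : ℕ => ((k * Real.log p : ℝ) : ℂ) := by
  have h0 : Real.log p ≠ 0 := (Real.log_pos (by exact_mod_cast hp.out.one_lt)).ne'
  rw [← range_logAbs_orbit hy]
  refine unboundedSpectrum_mulOp ?_
  rw [range_logAbs_orbit hy]
  exact isClosed_range_nat_mul h0

theorem isPositiveEnergy_rep {y : AdeleAt p} (hy : y ∈ unitBox p) :
    IsPositiveEnergy (fun t a => evolution p t a) (fun a => rep y a) (hamiltonian y) :=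
  ⟨⟨isSelfAdjoint_mulOp _, _, isExpOf_expMul _, rep_evolution y⟩,
    mulOp_nonneg fun k => logAbs_nonneg (mem_boundedFractions_of_mem_orbit hy k.2)⟩

/-! ### The Gibbs functionals -/

theorem norm_weighted_diag_le {y : AdeleAt p} (β : ℝ) (a : Alg p) (k : Orbit y) :
    ‖(Real.exp (-β * logAbs p k.1) : ℂ) * rep y a (basisVec k) k‖ ≤
      Real.exp (-β * logAbs p k.1) * ‖a‖ := by
  rw [norm_mul, Complex.norm_real, Real.norm_of_nonneg (Real.exp_pos _).le]
  exact mul_le_mul_of_nonneg_left ((norm_coeff_le _ k k).trans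
    (NonUnitalStarAlgHom.norm_apply_le (rep y) a)) (Real.exp_pos _).le

theorem summable_weighted_diag {y : AdeleAt p} (hy : y ∈ unitBox p) {β : ℝ} (hβ : 1 < β)
    (a : Alg p) :
    Summable fun k : Orbit y => (Real.exp (-β * logAbs p k.1) : ℂ) * rep y a (basisVec k) k :=
  summable_mul_diag (hasSum_orbit hy hβ).summable (fun _ => (Real.exp_pos _).le) _

/-- The functional `a ↦ Tr(e^{-βH_y} π_y(a))`. -/
def gibbs {β : ℝ} (hβ : 1 < β) (y : unitBox p) : StrongDual ℂ (Alg p) :=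
  LinearMap.mkContinuous
    { toFun := fun a => ∑' k : Orbit y.1,
        (Real.exp (-β * logAbs p k.1) : ℂ) * rep y.1 a (basisVec k) k
      map_add' := fun a b => by
        rw [← (summable_weighted_diag y.2 hβ a).tsum_add (summable_weighted_diag y.2 hβ b)]
        refine tsum_congr fun k => ?_
        rw [map_add, ← mul_add]
        rfl
      map_smul' := fun c a => by
        rw [RingHom.id_apply, smul_eq_mul, ← tsum_mul_left]
        refine tsum_congr fun k => ?_
        rw [map_smul, mul_left_comm]
        rfl }
    (partitionFunction p (absInf y.1)⁻¹ β) fun a =>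
      tsum_of_norm_bounded ((hasSum_orbit y.2 hβ).mul_right ‖a‖) (norm_weighted_diag_le β a)

theorem gibbs_apply {β : ℝ} (hβ : 1 < β) (y : unitBox p) (a : Alg p) :
    gibbs hβ y a = ∑' k : Orbit y.1,
      (Real.exp (-β * logAbs p k.1) : ℂ) * rep y.1 a (basisVec k) k := rfl

theorem partitionFunction_nonneg {y : AdeleAt p} (hy : y ∈ unitBox p) {β : ℝ} (hβ : 1 < β) :
    0 ≤ partitionFunction p (absInf y)⁻¹ β :=
  (hasSum_orbit hy hβ).nonneg fun _ => (Real.exp_pos _).le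

theorem norm_gibbs_le {β : ℝ} (hβ : 1 < β) (y : unitBox p) :
    ‖gibbs hβ y‖ ≤ partitionFunction p (absInf y.1)⁻¹ β :=
  LinearMap.mkContinuous_norm_le _ (partitionFunction_nonneg y.2 hβ) _

theorem gibbs_of {β : ℝ} (hβ : 1 < β) (y : unitBox p) (f : Cc ℚˣ (AdeleAt p) (openBox p)) :
    gibbs hβ y (CStar.of f) = ∑' k : Orbit y.1,
      (Real.exp (-β * logAbs p k.1) : ℂ) * f 1 (k.1 • y.1) := by
  rw [gibbs_apply]
  exact tsum_congr fun k => by rw [rep_of, regOp_basisVec_self]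

/-- The diagonal entries of `π_y(a)* π_y(a)` are the squared norms of the columns of `π_y(a)`, which
makes positivity visible. -/
theorem gibbs_star_mul_self {β : ℝ} (hβ : 1 < β) (y : unitBox p) (a : Alg p) :
    gibbs hβ y (star a * a) = ((∑' k : Orbit y.1,
      Real.exp (-β * logAbs p k.1) * ‖rep y.1 a (basisVec k)‖ ^ 2 : ℝ) : ℂ) := by
  rw [gibbs_apply, Complex.ofReal_tsum]
  refine tsum_congr fun k => ?_
  rw [map_mul, map_star, ContinuousLinearMap.star_eq_adjoint, mul_apply_eq_comp,
    ← inner_basisVec_left, ContinuousLinearMap.adjoint_inner_right, inner_self_eq_norm_sq_to_K]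
  push_cast
  rfl

theorem isKMS_gibbs {β : ℝ} (hβ : 1 < β) (y : unitBox p) :
    IsKMS (fun t a => evolution p t a) β (gibbs hβ y) := by
  intro a b
  obtain ⟨F, h1, h2, h3, h4, h5⟩ := exists_kms_function (zero_lt_one.trans hβ)
    (hasSum_orbit y.2 hβ).summable (rep y.1 a) (rep y.1 b)
  refine ⟨F, h1, h2, h3, fun t => ?_, fun t => ?_⟩
  · rw [h4, gibbs_apply, map_mul, rep_evolution]
  · rw [h5, gibbs_apply, map_mul, rep_evolution]

/-- The orbit, and hence the index set of the sum, varies with `y`. Since `f 1` vanishes outside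
`openBox p`, the sum may be taken over the fixed set `boundedFractions p p` instead; its terms are
continuous in `y` and dominated uniformly. -/
theorem continuous_gibbs_of {β : ℝ} (hβ : 1 < β) (f : Cc ℚˣ (AdeleAt p) (openBox p)) :
    Continuous fun y : unitBox p => gibbs hβ y (CStar.of f) := by
  have h1 : ∀ y : unitBox p, gibbs hβ y (CStar.of f) = ∑' k : boundedFractions p p,
      (Real.exp (-β * logAbs p k) : ℂ) * f 1 ((k : ℚˣ) • y.1) := by
    intro y
    have hsup : Function.support (fun k : ℚˣ =>
        (Real.exp (-β * logAbs p k) : ℂ) * f 1 (k • y.1)) ⊆ {k | k • y.1 ∈ openBox p} :=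
      fun k hk => (f.mem_arrows (right_ne_zero_of_mul hk)).1
    rw [gibbs_of]
    exact (tsum_subtype_eq_of_support_subset hsup).trans
      (tsum_subtype_eq_of_support_subset (hsup.trans
        fun k hk => mem_boundedFractions_of_mem_orbit y.2 hk)).symm
  simp only [h1]
  refine continuous_tsum (fun k => ?_) ((hasSum_boundedFractions hβ).summable.mul_right
    (⨆ x, ‖f 1 x‖)) fun k y => ?_
  · exact continuous_const.mul ((f.2.2 1).1.comp
      ((continuous_const_smul (k : ℚˣ)).comp continuous_subtype_val))
  · rw [norm_mul, Complex.norm_real, Real.norm_of_nonneg (Real.exp_pos _).le]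
    exact mul_le_mul_of_nonneg_left (f.norm_le_iSup 1 _) (Real.exp_pos _).le

/-- The norms of the functionals are bounded uniformly in `y`, so approximating `a` by elements of
`C_c(G)` gives uniform approximation by continuous functions of `y`. -/
theorem continuous_gibbs {β : ℝ} (hβ : 1 < β) (a : Alg p) :
    Continuous fun y : unitBox p => gibbs hβ y a := by
  have hM : ∀ y : unitBox p, ‖gibbs hβ y‖ ≤ |partitionFunction p p β| + 1 := fun y =>
    (norm_gibbs_le hβ y).trans ((partitionFunction_le y.2 hβ).trans
      ((le_abs_self _).trans (by linarith)))
  set M := |partitionFunction p p β| + 1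
  have hM0 : 0 < M := by positivity
  refine continuous_of_uniform_approx_of_continuous fun u hu => ?_
  obtain ⟨ε, hε, hu⟩ := Metric.mem_uniformity_dist.1 hu
  obtain ⟨f, hf⟩ := (CStar.isDenseInducing_of (U := openBox p)).dense.exists_dist_lt a
    (div_pos hε hM0)
  refine ⟨_, continuous_gibbs_of hβ f, fun y => hu ?_⟩
  rw [dist_eq_norm, ← map_sub]
  refine ((gibbs hβ y).le_opNorm _).trans_lt ?_
  rw [dist_eq_norm, lt_div_iff₀ hM0] at hf
  exact (mul_le_mul_of_nonneg_right (hM y) (norm_nonneg _)).trans_lt (by linarith)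

/-- Urysohn functions, as elements of the convolution algebra supported on the units. -/
theorem exists_unit_bump {K : Set (AdeleAt p)} (hK : IsCompact K) (hKU : K ⊆ openBox p) :
    ∃ (f : Cc ℚˣ (AdeleAt p) (openBox p)) (g : AdeleAt p → ℝ), f.ellOne ≤ 1 ∧
      (∀ x, f 1 x = g x) ∧ (∀ x, 0 ≤ g x) ∧ ∀ x ∈ K, g x = 1 := by
  classical
  -- The compact `L` between `K` and the open box keeps the closed support of the bump function, and
  -- not merely the set where it is nonzero, inside the box.
  obtain ⟨L, hL, hKL, hLU⟩ := exists_compact_between hK isOpen_openBox hKU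
  obtain ⟨g, hg1, hg0, hgc, hg⟩ := exists_continuous_one_zero_of_isCompact hK
    isOpen_interior.isClosed_compl (Set.disjoint_compl_right_iff_subset.2 hKL)
  have hsup : Function.support g ⊆ L := fun x hx => by
    by_contra hxL
    exact hx (hg0 fun h => hxL (interior_subset h))
  have hts : tsupport (fun x => (g x : ℂ)) ⊆ openBox p := by
    refine (closure_minimal (fun x hx => hsup fun h => ?_) hL.isClosed).trans hLU
    exact hx (by simp [h])
  let F : ℚˣ → AdeleAt p → ℂ := fun k => if k = 1 then fun x => (g x : ℂ) else 0
  have hF : F ∈ ccSubmodule ℚˣ (AdeleAt p) (openBox p) := by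
    refine ⟨(Set.finite_singleton 1).subset fun k hk => ?_, fun k => ?_⟩
    · by_contra h
      exact hk (if_neg h)
    · by_cases h : k = 1
      · simp only [F, h, if_true]
        refine ⟨Complex.continuous_ofReal.comp g.continuous,
          hgc.comp_left (g := fun r : ℝ => (r : ℂ)) Complex.ofReal_zero, fun x hx => ?_⟩
        exact ⟨hts hx, by rw [one_smul]; exact hts hx⟩
      · simp only [F, h, if_false]
        exact ⟨continuous_const, HasCompactSupport.zero, by simp [tsupport]⟩
  refine ⟨⟨F, hF⟩, g, ?_, fun x => by simp [F], fun x => (hg x).1, fun x hx => hg1 hx⟩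
  have h1 := Cc.ellOne_le (f := (⟨F, hF⟩ : Cc ℚˣ (AdeleAt p) (openBox p))) (S := {1})
    (C := fun _ => 1) (fun k hk => ?_) (fun _ => zero_le_one) fun k x => ?_
  · simpa using h1
  · by_contra h
    have h0 : F k = 0 := if_neg fun h' => h (Finset.mem_singleton.2 h')
    simp [Cc.supp, h0] at hk
  · change ‖F k x‖ ≤ 1
    by_cases h : k = 1
    · simp only [F, h, if_true, Complex.norm_real, Real.norm_of_nonneg (hg x).1]
      exact (hg x).2
    · simp [F, h]

/-- For the lower bound, take a finite part `s` of the orbit. A bump function on the units that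
equals `1` at these points has norm at most `1`, and by nonnegativity the functional takes on it a
value at least the partial sum of the weights over `s`. -/
theorem norm_gibbs {β : ℝ} (hβ : 1 < β) (y : unitBox p) :
    ‖gibbs hβ y‖ = partitionFunction p (absInf y.1)⁻¹ β := by
  refine le_antisymm (norm_gibbs_le hβ y) (hasSum_le_of_sum_le (hasSum_orbit y.2 hβ) fun s => ?_)
  obtain ⟨f, g, hf, hfg, hg0, hg1⟩ := exists_unit_bump (p := p)
    (K := (fun k : Orbit y.1 => k.1 • y.1) '' s) (s.finite_toSet.image _).isCompact
    (by rintro _ ⟨k, -, rfl⟩; exact k.2)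
  have hreal : gibbs hβ y (CStar.of f) =
      ((∑' k : Orbit y.1, Real.exp (-β * logAbs p k.1) * g (k.1 • y.1) : ℝ) : ℂ) := by
    rw [gibbs_of, Complex.ofReal_tsum]
    exact tsum_congr fun k => by rw [hfg, Complex.ofReal_mul]
  have hsum : Summable fun k : Orbit y.1 =>
      Real.exp (-β * logAbs p k.1) * g (k.1 • y.1) := by
    have h := summable_weighted_diag y.2 hβ (CStar.of f)
    refine Complex.summable_ofReal.1 (h.congr fun k => ?_)
    rw [rep_of, regOp_basisVec_self, hfg, Complex.ofReal_mul]
  have hle : ‖gibbs hβ y (CStar.of f)‖ ≤ ‖gibbs hβ y‖ := by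
    refine ((gibbs hβ y).le_opNorm _).trans (mul_le_of_le_one_right (norm_nonneg _) ?_)
    rw [CStar.norm_of]
    exact f.fullNorm_le_ellOne.trans hf
  refine le_trans ?_ hle
  rw [hreal, Complex.norm_real]
  refine le_trans ?_ (Real.le_norm_self _)
  refine le_trans (le_of_eq (Finset.sum_congr rfl fun k hk => ?_)) (hsum.sum_le_tsum s
    fun k _ => mul_nonneg (Real.exp_pos _).le (hg0 _))
  rw [hg1 _ ⟨k, hk, rfl⟩, mul_one]

end Orbits

end ValuationSystem
end

open ValuationSystem in
theorem theorem8p13 (p : ℕ) [Fact p.Prime] :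
    -- positive energy and the spectrum of the Hamiltonian
    (∀ y ∈ unitBox p,
      IsPositiveEnergy (fun t a => evolution p t a) (fun a => rep y a) (hamiltonian y) ∧
      unboundedSpectrum (hamiltonian y) = Set.range fun k : ℕ => ((k * Real.log p : ℝ) : ℂ)) ∧
    ∀ β : ℝ, 1 < β →
      -- the partition function
      (∀ y ∈ unitBox p, ∀ lam : ℝ, absInf y = lam⁻¹ →
        HasTrace (expNegHamiltonian β y) (partitionFunction p lam β : ℂ)) ∧
      -- the KMS functionals
      ∃ ψ : unitBox p → StrongDual ℂ (Alg p),
        (∀ (y : unitBox p) (a : Alg p),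
          HasTrace (expNegHamiltonian β y.1 * rep y.1 a) (ψ y a)) ∧
        (∀ (y : unitBox p) (a : Alg p),
          0 ≤ (ψ y (star a * a)).re ∧ (ψ y (star a * a)).im = 0) ∧
        (∀ y : unitBox p, ‖ψ y‖ = partitionFunction p (absInf y.1)⁻¹ β) ∧
        (∀ y : unitBox p, IsKMS (fun t a => evolution p t a) β (ψ y)) ∧
        ∀ a : Alg p, Continuous fun y : unitBox p => ψ y a := by
  refine ⟨fun y hy => ⟨isPositiveEnergy_rep hy, unboundedSpectrum_hamiltonian hy⟩, fun β hβ =>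
    ⟨fun y hy lam hlam => ?_, gibbs hβ, fun y a => hasTrace_expNegHamiltonian_mul y.2 hβ _,
      fun y a => ?_, norm_gibbs hβ, isKMS_gibbs hβ, continuous_gibbs hβ⟩⟩
  · rw [show lam = (absInf y)⁻¹ by rw [hlam, inv_inv]]
    exact hasTrace_expNegHamiltonian hy hβ
  · rw [gibbs_star_mul_self, Complex.ofReal_re, Complex.ofReal_im]
    exact ⟨tsum_nonneg fun k => mul_nonneg (Real.exp_pos _).le (sq_nonneg _), rfl⟩
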